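/- Setting. Let $E\neq\{0\}$ be a real normed space. In the Steiner Tree with Minimum Number of Steiner Points problem (ST-MSP) in $E$, one is given a finite set $R\subseteq E$ of terminals and has to find a finite family $S$ of points of $E$ (several may be placed at the same location) of minimum size such that the unit-disk graph of $R\cup S$ (two different nodes are adjacent if their points are at distance at most $1$) contains a path between any two terminals. Let $\Delta$ be the maximum number of points in the closed unit ball of $E$ such that the distance between any two of them is larger than $1$; assume that this maximum exists. Algorithms are programs of a step-counting list-processing machine, whose values are binary trees with leaves that may carry atoms from an arbitrary set, and which may have, besides list processing, an arbitrary fixed family of further unit-cost operations. Points of $E$ are given by values of the machine, through an arbitrary fixed partial decoding map from values to points. (Turing machines, up to polynomials, and the real RAM are covered.) "Polynomial time" means that the number of steps plus the length of the output is at most a fixed polynomial in the sum of the length of the input and the maximum distance between terminals, rounded up; so, if the maximum distance between terminals is polynomial in the number of terminals, it is polynomial in the length of the input. Theorem. Let $E\neq\{0\}$ be a real normed space for which $\Delta$ is defined, and fix a machine and a decoding of points as above. Suppose that for every constant $k$ there is a polynomial-time algorithm that finds an optimal solution of every ST-MSP instance in $E$ with at most $k$ terminals. Then, for every $\varepsilon>0$,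 there is a polynomial-time algorithm, on the same machine and for the same decoding, that for every ST-MSP instance in $E$ finds a feasible solution with at most $(1+\ln(\Delta-1)+\varepsilon)\,\mathsf{opt}$ points, where $\mathsf{opt}$ is the minimum size of a feasible solution. In particular, for the Euclidean plane $\mathbb{R}^2$ we have $\Delta=5$, so that, under the same assumption on instances with a constant number of terminals, the ratio is $1+\ln 4+\varepsilon<2.3863+\varepsilon$. -/

import Mathlib

namespace STMSP

/-! ## The geometric problem -/

/-- The unit-disk graph of a family `pos : V → M` of points of a metric space: two different nodes
are adjacent when their points are at distance at most one. Nodes are indices, so several nodes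
may be placed at the same location. -/
def unitDiskGraph {V M : Type*} [MetricSpace M] (pos : V → M) : SimpleGraph V where
  Adj i j := i ≠ j ∧ dist (pos i) (pos j) ≤ 1
  symm := ⟨fun i j h => ⟨h.1.symm, by rw [dist_comm]; exact h.2⟩⟩
  loopless := ⟨fun _ h => h.1 rfl⟩

/-- The placement of the terminals `R` together with the added (Steiner) points `S`. The points of
`S` are listed with repetition: several may be placed at the same location. -/
def placement {M : Type*} (R : Finset M) (S : List M) : R ⊕ Fin S.length → M :=
  Sum.elim (fun x => (x : M)) S.get

/-- `S` is a feasible solution for the terminal set `R`: the unit-disk graph of the terminals and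
the points of `S` contains a path between any two terminals. -/
def Feasible {M : Type*} [MetricSpace M] (R : Finset M) (S : List M) : Prop :=
  ∀ u v : R, (unitDiskGraph (placement R S)).Reachable (Sum.inl u) (Sum.inl v)

/-- `S` is an optimal solution: feasible, and no feasible solution has fewer points. -/
def IsOptimal {M : Type*} [MetricSpace M] (R : Finset M) (S : List M) : Prop :=
  Feasible R S ∧ ∀ S' : List M, Feasible R S' → S.length ≤ S'.length

/-- `S` is a `ρ`-approximate solution: feasible, and with at most `ρ` times as many points as any
feasible solution. -/
def IsApproximate {M : Type*} [MetricSpace M] (ρ : ℝ) (R : Finset M) (S : List M) : Prop :=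
  Feasible R S ∧ ∀ S' : List M, Feasible R S' → (S.length : ℝ) ≤ ρ * (S'.length : ℝ)

/-- `Δ` is the maximum number of points in the closed unit ball of the normed space `E` such that
the distance between any two of them is larger than one (in particular, the maximum exists). -/
def IsIndependenceNumber (E : Type*) [NormedAddCommGroup E] (Δ : ℕ) : Prop :=
  IsGreatest {n : ℕ | ∃ s : Finset E, (s : Set E) ⊆ Metric.closedBall (0 : E) 1 ∧
    (s : Set E).Pairwise (fun x y => 1 < dist x y) ∧ s.card = n} Δ

/-! ## Polynomial time

A list-processing machine: values are binary trees (lists, pairs, unary or binary numerals and so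
on are built from `nil` and `pair`), whose leaves may carry atoms, and a program is a while-program
on such trees, with a step count. The machine may have further unit-cost operations. With no atoms
and no further operations, polynomial time is the usual polynomial time of Turing machines; with
real numbers as atoms and with real arithmetic as operations, it is that of the real RAM. -/

/-- The values of the machine: binary trees whose leaves are `nil` or atoms. -/
inductive Data (α : Type*) where
  | nil : Data α
  | atom (a : α) : Data α
  | pair (x y : Data α) : Data α

namespace Data

variable {α : Type*}

/-- The number of nodes of a tree. -/
def size : Data α → ℕ
  | nil => 1
  | atom _ => 1
  | pair x y => size x + size y + 1

/-- The first component of a pair (`nil` for other values). -/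
def first : Data α → Data α
  | pair x _ => x
  | _ => nil

/-- The second component of a pair (`nil` for other values). -/
def second : Data α → Data α
  | pair _ y => y
  | _ => nil

/-- A list of values as one value. -/
def ofList : List (Data α) → Data α
  | [] => nil
  | c :: cs => pair c (ofList cs)

end Data

/-- Programs, each turning an input value into an output value; the unit-cost operations that the
machine has beyond list processing are named by `ι`. -/
inductive Prog (ι : Type*) where
  | op (i : ι) : Prog ι
  | ident : Prog ι
  | nil : Prog ι
  | first : Prog ι
  | second : Prog ι
  | pair (p q : Prog ι) : Prog ι
  | seq (p q : Prog ι) : Prog ι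
  | ite (c p q : Prog ι) : Prog ι
  | loop (c p : Prog ι) : Prog ι

/-- `Eval op p x y t`: on the machine whose additional unit-cost operations are `op`, the program
`p` halts on input `x` with output `y` after `t` steps. A test fails when its value is `nil`, and
succeeds otherwise; `loop c p` is "while `c` do `p`". -/
inductive Eval {α ι : Type*} (op : ι → Data α → Data α) :
    Prog ι → Data α → Data α → ℕ → Prop where
  | op (i : ι) (x : Data α) : Eval op (Prog.op i) x (op i x) 1
  | ident (x : Data α) : Eval op Prog.ident x x 1
  | nil (x : Data α) : Eval op Prog.nil x Data.nil 1
  | first (x : Data α) : Eval op Prog.first x x.first 1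
  | second (x : Data α) : Eval op Prog.second x x.second 1
  | pair {p q : Prog ι} {x y z : Data α} {s t : ℕ} (hp : Eval op p x y s) (hq : Eval op q x z t) :
      Eval op (Prog.pair p q) x (Data.pair y z) (s + t + 1)
  | seq {p q : Prog ι} {x y z : Data α} {s t : ℕ} (hp : Eval op p x y s) (hq : Eval op q y z t) :
      Eval op (Prog.seq p q) x z (s + t + 1)
  | ite_true {c p q : Prog ι} {x b y : Data α} {s t : ℕ} (hc : Eval op c x b s)
      (hb : b ≠ Data.nil) (hp : Eval op p x y t) : Eval op (Prog.ite c p q) x y (s + t + 1)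
  | ite_false {c p q : Prog ι} {x y : Data α} {s t : ℕ} (hc : Eval op c x Data.nil s)
      (hq : Eval op q x y t) : Eval op (Prog.ite c p q) x y (s + t + 1)
  | loop_done {c p : Prog ι} {x : Data α} {s : ℕ} (hc : Eval op c x Data.nil s) :
      Eval op (Prog.loop c p) x x (s + 1)
  | loop_step {c p : Prog ι} {x b y z : Data α} {s t r : ℕ} (hc : Eval op c x b s)
      (hb : b ≠ Data.nil) (hp : Eval op p x y t) (hl : Eval op (Prog.loop c p) y z r) :
      Eval op (Prog.loop c p) x z (s + t + r + 1)

/-- Execution is deterministic: the input determines the output and the number of steps. -/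
theorem Eval.deterministic {α ι : Type*} {op : ι → Data α → Data α} {p : Prog ι}
    {x y y' : Data α} {t t' : ℕ} (h : Eval op p x y t) (h' : Eval op p x y' t') :
    y = y' ∧ t = t' := by
  induction h generalizing y' t' with
  | op i x => cases h'; exact ⟨rfl, rfl⟩
  | ident x => cases h'; exact ⟨rfl, rfl⟩
  | nil x => cases h'; exact ⟨rfl, rfl⟩
  | first x => cases h'; exact ⟨rfl, rfl⟩
  | second x => cases h'; exact ⟨rfl, rfl⟩
  | pair _ _ ih₁ ih₂ =>
    cases h' with
    | pair h₁ h₂ =>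
      obtain ⟨rfl, rfl⟩ := ih₁ h₁
      obtain ⟨rfl, rfl⟩ := ih₂ h₂
      exact ⟨rfl, rfl⟩
  | seq _ _ ih₁ ih₂ =>
    cases h' with
    | seq h₁ h₂ =>
      obtain ⟨rfl, rfl⟩ := ih₁ h₁
      obtain ⟨rfl, rfl⟩ := ih₂ h₂
      exact ⟨rfl, rfl⟩
  | ite_true _ hb _ ih₁ ih₂ =>
    cases h' with
    | ite_true h₁ _ h₂ =>
      obtain ⟨rfl, rfl⟩ := ih₁ h₁
      obtain ⟨rfl, rfl⟩ := ih₂ h₂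
      exact ⟨rfl, rfl⟩
    | ite_false h₁ _ => exact absurd (ih₁ h₁).1 hb
  | ite_false _ _ ih₁ ih₂ =>
    cases h' with
    | ite_true h₁ hb _ => exact absurd (ih₁ h₁).1.symm hb
    | ite_false h₁ h₂ =>
      obtain ⟨-, rfl⟩ := ih₁ h₁
      obtain ⟨rfl, rfl⟩ := ih₂ h₂
      exact ⟨rfl, rfl⟩
  | loop_done _ ih =>
    cases h' with
    | loop_done h₁ =>
      obtain ⟨-, rfl⟩ := ih h₁
      exact ⟨rfl, rfl⟩
    | loop_step h₁ hb _ _ => exact absurd (ih h₁).1.symm hb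
  | loop_step _ hb _ _ ih₁ ih₂ ih₃ =>
    cases h' with
    | loop_done h₁ => exact absurd (ih₁ h₁).1 hb
    | loop_step h₁ _ h₂ h₃ =>
      obtain ⟨-, rfl⟩ := ih₁ h₁
      obtain ⟨rfl, rfl⟩ := ih₂ h₂
      obtain ⟨rfl, rfl⟩ := ih₃ h₃
      exact ⟨rfl, rfl⟩

/-- The value `v` is a list of codes of the points `xs`, in this order; `decode` tells which point,
if any, a value is a code of. -/
def EncodesList {α M : Type*} (decode : Data α → Option M) (v : Data α) (xs : List M) : Prop :=
  ∃ cs : List (Data α), v = Data.ofList cs ∧ cs.map decode = xs.map some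

/-- The value `v` lists codes of the points of `R`, each point once, in any order. -/
def EncodesFinset {α M : Type*} (decode : Data α → Option M) (v : Data α) (R : Finset M) : Prop :=
  ∃ xs : List M, EncodesList decode v xs ∧ (xs : Multiset M) = R.val

/-- Some program computes, for every terminal set `R` with `P R`, a list `S` of points with
`Good R S`, in time polynomial in the length of the input and the maximum distance between
terminals. The length of the output is added to the number of steps, since a step can copy a
reference to a large value. (So the time is polynomial in the length of the input alone on instances in which the
maximum distance between terminals is polynomial in the number of terminals.) -/
def PolyTimeComputes {α ι M : Type*} [MetricSpace M] (op : ι → Data α → Data α)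
    (decode : Data α → Option M) (P : Finset M → Prop) (Good : Finset M → List M → Prop) : Prop :=
  ∃ (prog : Prog ι) (bound : Polynomial ℕ), ∀ (R : Finset M) (v : Data α), P R →
    EncodesFinset decode v R → ∃ (w : Data α) (t : ℕ) (S : List M),
      Eval op prog v w t ∧
      t + w.size ≤ bound.eval (v.size + ⌈Metric.diam (R : Set M)⌉₊) ∧
      EncodesList decode w S ∧ Good R S

/-- For every constant `k`, the instances with at most `k` terminals can be solved to optimality
in polynomial time. -/
def ConstantTerminalsSolvable {α ι M : Type*} [MetricSpace M] (op : ι → Data α → Data α)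
    (decode : Data α → Option M) : Prop :=
  ∀ k : ℕ, PolyTimeComputes op decode (fun R => R.card ≤ k) IsOptimal

/-- For every `ε > 0` there is a polynomial-time algorithm that, on every instance, computes a
`(ρ + ε)`-approximate solution. -/
def HasApproximationScheme {α ι M : Type*} [MetricSpace M] (op : ι → Data α → Data α)
    (decode : Data α → Option M) (ρ : ℝ) : Prop :=
  ∀ ε : ℝ, 0 < ε → PolyTimeComputes op decode (fun _ => True) (IsApproximate (ρ + ε))

end STMSP

namespace STMSP

/-! Write `ρ` for `1 + ln (Δ - 1)` and fix an integer `r > 2 * ρ / ε`. The algorithm lists all sets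
of at most `Δ ^ r + 1` terminals, lets the assumed algorithm solve each of them optimally, and
combines these candidates by greedy contraction. Since `r` is constant, there are polynomially many
candidates.

The potential is the cost of a minimum spanning tree after contracting the chosen candidates `H`.
Costs are integers, so by Kruskal it equals the sum over `t` of the number of components, minus one,
of the hypergraph of `H` and all candidates of cost at most `t` (`excess`). Each step takes a
candidate with the least ratio of cost to decrease of the potential. Drops in component counts only
shrink as hyperedges are added (`numLabels_le_add_sum`); hence, for any family of candidates of
total cost `o` that connects everything, the individual decreases add up to at least the current
potential `m`, and some candidate has ratio at most `o / m`. The cheapest candidate that is still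
useful has ratio at most `1` (`exists_cost_le_gain`). So going from `m` to `m'` costs at most `(m -
m') * min 1 (o / m)`, and the total is at most the integral of `min 1 (o / x)` from `0` to the
initial potential (`greedy_spec`).

Geometry enters twice. First, the initial potential is at most `(Δ - 1) * o`, which makes that
integral at most `ρ * o`: two terminals at distance at most `t + 1` are joined by `t` points, and
inserting the points of a solution one by one, each next to an earlier point, lowers the sum over
`t` of the component counts of the threshold graphs by at most `Δ - 1` per point
(`sum_numComponents_sub_one_le`). Second, every solution splits into parts with at most `Δ ^ r + 1`
terminals at a loss of a factor `1 + 2 / r` (`exists_restricted`). So `o ≤ (1 + 2 / r) * opt` for a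
suitable family, and the choice of `r` gives the ratio `ρ + ε`.

For the plane, `Δ = 5`: a pentagon gives the lower bound, and sectors of angle `π / 3` the upper
bound. -/

theorem eval_mono (b : Polynomial ℕ) {m n : ℕ} (h : m ≤ n) : b.eval m ≤ b.eval n := by
  simp only [Polynomial.eval_eq_sum, Polynomial.sum]
  exact Finset.sum_le_sum fun i _ => Nat.mul_le_mul_left _ (Nat.pow_le_pow_left h i)

/-! ### Encodings as trees and their sizes -/

/-- Types whose elements are represented by values of the machine. -/
class HasRep (α X : Type*) where
  rep : X → Data α

open HasRep

section Instances

variable {α : Type*}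

instance : HasRep α (Data α) := ⟨fun x => x⟩

instance : HasRep α Unit := ⟨fun _ => Data.nil⟩

instance : HasRep α Bool := ⟨fun b => if b then Data.pair Data.nil Data.nil else Data.nil⟩

/-- Unary numerals. -/
def unary : ℕ → Data α
  | 0 => Data.nil
  | n + 1 => Data.pair Data.nil (unary n)

instance : HasRep α ℕ := ⟨unary⟩

instance {X Y : Type*} [HasRep α X] [HasRep α Y] : HasRep α (X × Y) :=
  ⟨fun p => Data.pair (rep p.1) (rep p.2)⟩

instance {X : Type*} [HasRep α X] : HasRep α (List X) := ⟨fun l => Data.ofList (l.map rep)⟩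

end Instances

/-- The size of the representation of an element. -/
def sz (α : Type*) {X : Type*} [HasRep α X] (x : X) : ℕ := (rep x : Data α).size

section Size

variable {α : Type*} {X Y : Type*} [HasRep α X] [HasRep α Y]

@[simp] theorem rep_nil : (rep ([] : List X) : Data α) = Data.nil := rfl

@[simp] theorem rep_cons (a : X) (l : List X) :
    (rep (a :: l) : Data α) = Data.pair (rep a) (rep l) := rfl

@[simp] theorem rep_pair (p : X × Y) : (rep p : Data α) = Data.pair (rep p.1) (rep p.2) := rfl

@[simp] theorem rep_zero : (rep (0 : ℕ) : Data α) = Data.nil := rfl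

@[simp] theorem rep_succ (n : ℕ) : (rep (n + 1) : Data α) = Data.pair Data.nil (rep n) := rfl

@[simp] theorem rep_true : (rep true : Data α) = Data.pair Data.nil Data.nil := rfl

@[simp] theorem rep_false : (rep false : Data α) = Data.nil := rfl

@[simp] theorem rep_data (d : Data α) : (rep d : Data α) = d := rfl

@[simp] theorem sz_nil : sz α ([] : List X) = 1 := rfl

@[simp] theorem sz_cons (a : X) (l : List X) : sz α (a :: l) = sz α a + sz α l + 1 := rfl

@[simp] theorem sz_pair (x : X) (y : Y) : sz α (x, y) = sz α x + sz α y + 1 := rfl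

@[simp] theorem sz_nat (n : ℕ) : sz α n = 2 * n + 1 := by
  induction n with
  | zero => rfl
  | succ n ih =>
    have : sz α (n + 1) = 1 + sz α n + 1 := rfl
    omega

theorem sz_append (l₁ l₂ : List X) : sz α (l₁ ++ l₂) + 1 = sz α l₁ + sz α l₂ := by
  induction l₁ with
  | nil => simp; omega
  | cons a l ih => simp only [List.cons_append, sz_cons]; omega

theorem sz_le_of_mem {a : X} {l : List X} (h : a ∈ l) : sz α a ≤ sz α l := by
  induction l with
  | nil => simp at h
  | cons b l ih =>
    rcases List.mem_cons.1 h with rfl | h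
    · simp only [sz_cons]; omega
    · have := ih h; simp only [sz_cons]; omega

theorem length_le_sz (l : List X) : l.length ≤ sz α l := by
  induction l with
  | nil => simp
  | cons b l ih => simp only [sz_cons, List.length_cons]; omega

theorem sz_le_of_forall_le (l : List X) (B : ℕ) (h : ∀ a ∈ l, sz α a ≤ B) :
    sz α l ≤ l.length * (B + 1) + 1 := by
  induction l with
  | nil => simp
  | cons b l ih =>
    have h1 := ih fun a ha => h a (List.mem_cons_of_mem _ ha)
    have h2 := h b List.mem_cons_self
    simp only [sz_cons, List.length_cons, add_mul, one_mul]
    omega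

end Size

/-! ### Closure properties of polynomial-time functions -/

/-- A function on represented types which a program computes in time (and with output length)
polynomial in the length of the input. -/
def PolyTime {α ι : Type*} (op : ι → Data α → Data α) {X Y : Type*} [HasRep α X] [HasRep α Y]
    (f : X → Y) : Prop :=
  ∃ (p : Prog ι) (b : Polynomial ℕ), ∀ x, ∃ t, Eval op p (rep x) (rep (f x)) t ∧
    t + sz α (f x) ≤ b.eval (sz α x)

/-- The program which folds the program `p` over a list: the input is a triple of a context, an
initial state and a list. -/
def foldProg {ι : Type*} (p : Prog ι) : Prog ι :=
  .seq (.loop (.seq .second .second)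
    (.pair .first (.pair
      (.seq (.pair .first (.pair (.seq .second .first) (.seq .second (.seq .second .first)))) p)
      (.seq .second (.seq .second .second)))))
    (.seq .second .first)

section Machine

variable {α ι : Type*} {op : ι → Data α → Data α}
variable {X Y Z S A B : Type*} [HasRep α X] [HasRep α Y] [HasRep α Z] [HasRep α S] [HasRep α A] [HasRep α B]

/-- The step program is only required to work on the states that actually occur, those reached after
a prefix of `l`. This admits step programs that are correct on valid data only, and time bounds that
rely on the size of the intermediate states. -/
theorem eval_foldProg {p : Prog ι} (c : Data α) (f : S → A → S) (N : ℕ) (l : List A) (s : S)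
    (h : ∀ l₁ a l₂, l = l₁ ++ a :: l₂ → ∃ t ≤ N,
      Eval op p (.pair c (.pair (rep (l₁.foldl f s)) (rep a)))
        (rep (f (l₁.foldl f s) a)) t) :
    ∃ t ≤ l.length * (N + 30) + 10,
      Eval op (foldProg p) (.pair c (.pair (rep s) (rep l))) (rep (l.foldl f s)) t := by
  suffices H : ∃ t ≤ l.length * (N + 30) + 4, Eval op (.loop (.seq .second .second)
      (.pair .first (.pair
      (.seq (.pair .first (.pair (.seq .second .first) (.seq .second (.seq .second .first)))) p)
      (.seq .second (.seq .second .second))))) (.pair c (.pair (rep s) (rep l)))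
      (.pair c (.pair (rep (l.foldl f s)) .nil)) t by
    obtain ⟨t, ht, hE⟩ := H
    exact ⟨_, by omega, .seq hE (.seq (.second _) (.first _))⟩
  induction l generalizing s with
  | nil =>
    exact ⟨_, by simp, .loop_done (.seq (.second _) (.second _))⟩
  | cons a l ih =>
    obtain ⟨t, ht, hE⟩ := h [] a l rfl
    obtain ⟨t', ht', hE'⟩ := ih (f s a) fun l₁ a' l₂ hl => by
      have := h (a :: l₁) a' l₂ (by rw [hl]; rfl)
      simpa using this
    refine ⟨_, ?_, .loop_step (.seq (.second _) (.second _)) (by simp [Data.second])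
      (.pair (.first _) (.pair (.seq (.pair (.first _) (.pair (.seq (.second _) (.first _))
        (.seq (.second _) (.seq (.second _) (.first _))))) hE)
        (.seq (.second _) (.seq (.second _) (.second _))))) hE'⟩
    simp only [List.length_cons, add_mul, one_mul]
    omega

namespace PolyTime

theorem id : PolyTime op (fun x : X => x) :=
  ⟨.ident, Polynomial.X + 1, fun x => ⟨1, .ident _, by simp [sz]; omega⟩⟩

theorem comp {g : Y → Z} {f : X → Y} (hg : PolyTime op g) (hf : PolyTime op f) :
    PolyTime op (fun x => g (f x)) := by
  obtain ⟨p, b, hp⟩ := hf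
  obtain ⟨q, d, hq⟩ := hg
  refine ⟨.seq p q, b + d.comp b + 1, fun x => ?_⟩
  obtain ⟨t, hE, ht⟩ := hp x
  obtain ⟨t', hE', ht'⟩ := hq (f x)
  refine ⟨_, .seq hE hE', ?_⟩
  have := eval_mono d (show sz α (f x) ≤ b.eval (sz α x) by omega)
  simp only [Polynomial.eval_add, Polynomial.eval_comp, Polynomial.eval_one]
  omega

/-- Programs see only representations, so changing the type of a value without changing its tree is
free. -/
theorem of_rep_eq {f : X → Y} {g : X → Z} (hf : PolyTime op f)
    (h : ∀ x, (rep (f x) : Data α) = rep (g x)) : PolyTime op g := by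
  obtain ⟨p, b, hp⟩ := hf
  refine ⟨p, b, fun x => ?_⟩
  obtain ⟨t, hE, ht⟩ := hp x
  refine ⟨t, h x ▸ hE, ?_⟩
  rw [sz] at ht ⊢
  rw [← h x]; exact ht

theorem pair {f : X → Y} {g : X → Z} (hf : PolyTime op f) (hg : PolyTime op g) :
    PolyTime op (fun x => (f x, g x)) := by
  obtain ⟨p, b, hp⟩ := hf
  obtain ⟨q, d, hq⟩ := hg
  refine ⟨.pair p q, b + d + 2, fun x => ?_⟩
  obtain ⟨t, hE, ht⟩ := hp x
  obtain ⟨t', hE', ht'⟩ := hq x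
  refine ⟨_, .pair hE hE', ?_⟩
  simp only [Polynomial.eval_add, Polynomial.eval_ofNat, sz_pair]
  omega

theorem first : PolyTime op (Data.first : Data α → Data α) := by
  refine ⟨.first, Polynomial.X + 1, fun x => ⟨1, .first _, ?_⟩⟩
  have : x.first.size ≤ x.size := by
    cases x <;> simp [Data.first, Data.size]; omega
  simp [sz]; omega

theorem second : PolyTime op (Data.second : Data α → Data α) := by
  refine ⟨.second, Polynomial.X + 1, fun x => ⟨1, .second _, ?_⟩⟩
  have : x.second.size ≤ x.size := by
    cases x <;> simp [Data.second, Data.size]; omega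
  simp [sz]; omega

theorem data {f : X → Y} (hf : PolyTime op f) : PolyTime op (fun x => (rep (f x) : Data α)) :=
  hf.of_rep_eq fun _ => rfl

theorem fst {f : X → Y × Z} (hf : PolyTime op f) : PolyTime op (fun x => (f x).1) :=
  (first.comp hf.data).of_rep_eq fun _ => rfl

theorem snd {f : X → Y × Z} (hf : PolyTime op f) : PolyTime op (fun x => (f x).2) :=
  (second.comp hf.data).of_rep_eq fun _ => rfl

theorem nilData : PolyTime op (fun _ : X => (Data.nil : Data α)) :=
  ⟨.nil, 2, fun x => ⟨1, .nil _, by simp [sz, Data.size]⟩⟩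

theorem nil : PolyTime op (fun _ : X => ([] : List Y)) := nilData.of_rep_eq fun _ => rfl

theorem zero : PolyTime op (fun _ : X => 0) := nilData.of_rep_eq fun _ => rfl

theorem unit : PolyTime op (fun _ : X => ()) := nilData.of_rep_eq fun _ => rfl

theorem false : PolyTime op (fun _ : X => Bool.false) := nilData.of_rep_eq fun _ => rfl

theorem true : PolyTime op (fun _ : X => Bool.true) :=
  (nilData.pair nilData).of_rep_eq fun _ => rfl

theorem cons {f : X → Y} {g : X → List Y} (hf : PolyTime op f) (hg : PolyTime op g) :
    PolyTime op (fun x => f x :: g x) := (hf.pair hg).of_rep_eq fun _ => rfl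

theorem succ {f : X → ℕ} (hf : PolyTime op f) : PolyTime op (fun x => f x + 1) :=
  (nilData.pair hf).of_rep_eq fun _ => rfl

theorem tail {f : X → List Y} (hf : PolyTime op f) : PolyTime op (fun x => (f x).tail) :=
  (second.comp hf.data).of_rep_eq fun x => by cases f x <;> rfl

theorem pred {f : X → ℕ} (hf : PolyTime op f) : PolyTime op (fun x => f x - 1) :=
  (second.comp hf.data).of_rep_eq fun x => by cases f x <;> rfl

theorem ite_nil {c : X → Data α} {f g : X → Y} [DecidablePred fun x => c x = Data.nil]
    (hc : PolyTime op c) (hf : PolyTime op f) (hg : PolyTime op g) :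
    PolyTime op (fun x => if c x = Data.nil then g x else f x) := by
  obtain ⟨pc, bc, hpc⟩ := hc
  obtain ⟨p, b, hp⟩ := hf
  obtain ⟨q, d, hq⟩ := hg
  refine ⟨.ite pc p q, bc + b + d + 1, fun x => ?_⟩
  obtain ⟨tc, hEc, htc⟩ := hpc x
  obtain ⟨t, hE, ht⟩ := hp x
  obtain ⟨t', hE', ht'⟩ := hq x
  simp only [Polynomial.eval_add, Polynomial.eval_one]
  by_cases h : c x = Data.nil
  · rw [rep_data, h] at hEc
    simp only [h, if_true]
    exact ⟨_, .ite_false hEc hE', by omega⟩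
  · simp only [h, if_false]
    exact ⟨_, .ite_true hEc h hE, by omega⟩

theorem cond {c : X → Bool} {f g : X → Y} (hc : PolyTime op c) (hf : PolyTime op f)
    (hg : PolyTime op g) : PolyTime op (fun x => bif c x then f x else g x) := by
  classical
  refine (ite_nil hc.data hf hg).of_rep_eq fun x => ?_
  cases h : c x <;> simp

theorem isEmpty {f : X → List Y} (hf : PolyTime op f) : PolyTime op (fun x => (f x).isEmpty) := by
  classical
  refine (ite_nil hf.data false true).of_rep_eq fun x => ?_
  cases f x <;> simp

theorem isZero {f : X → ℕ} (hf : PolyTime op f) : PolyTime op (fun x => decide (f x = 0)) := by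
  classical
  refine (ite_nil hf.data false true).of_rep_eq fun x => ?_
  cases f x <;> simp

theorem headD {f : X → List Y} {g : X → Y} (hf : PolyTime op f) (hg : PolyTime op g) :
    PolyTime op (fun x => (f x).headD (g x)) := by
  refine (cond hf.isEmpty hg.data (first.comp hf.data)).of_rep_eq fun x => ?_
  cases f x <;> simp [Data.first]

theorem and {f g : X → Bool} (hf : PolyTime op f) (hg : PolyTime op g) :
    PolyTime op (fun x => f x && g x) :=
  (cond hf hg false).of_rep_eq fun x => by cases f x <;> rfl

theorem not {f : X → Bool} (hf : PolyTime op f) : PolyTime op (fun x => !f x) :=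
  (cond hf false true).of_rep_eq fun x => by cases f x <;> rfl

/-- A polynomial-time step does not suffice, since iterating it may blow up the state exponentially;
hence the hypothesis `hq` on the size of every intermediate state. -/
theorem foldl {l : X → List A} {s : X → S} {f : X → S → A → S} (hl : PolyTime op l)
    (hs : PolyTime op s) (hf : PolyTime op fun p : X × S × A => f p.1 p.2.1 p.2.2)
    (q : Polynomial ℕ)
    (hq : ∀ x l₁ l₂, l x = l₁ ++ l₂ → sz α (l₁.foldl (f x) (s x)) ≤ q.eval (sz α x)) :
    PolyTime op fun x => (l x).foldl (f x) (s x) := by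
  obtain ⟨pl, bl, hpl⟩ := hl
  obtain ⟨ps, bs, hps⟩ := hs
  obtain ⟨p, b, hp⟩ := hf
  refine ⟨.seq (.pair .ident (.pair ps pl)) (foldProg p),
    bl + bs + bl * (b.comp (Polynomial.X + q + bl + 2) + 30) + q + 20, fun x => ?_⟩
  obtain ⟨tl, hEl, htl⟩ := hpl x
  obtain ⟨ts, hEs, hts⟩ := hps x
  obtain ⟨t, ht, hE⟩ := eval_foldProg (op := op) (p := p) (rep x) (f x)
    (b.eval (sz α x + q.eval (sz α x) + bl.eval (sz α x) + 2)) (l x) (s x) (by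
      intro l₁ a l₂ h
      obtain ⟨t, hE, ht⟩ := hp (x, l₁.foldl (f x) (s x), a)
      refine ⟨t, ?_, hE⟩
      have h1 := hq x l₁ (a :: l₂) h
      have h2 : sz α a ≤ sz α (l x) := sz_le_of_mem (by simp [h])
      refine le_trans (by omega) (ht.trans (eval_mono b ?_))
      simp only [sz_pair]
      omega)
  refine ⟨_, .seq (.pair (.ident _) (.pair hEs hEl)) hE, ?_⟩
  have h1 := hq x (l x) [] (by simp)
  have h2 := length_le_sz (α := α) (l x)
  have h3 : (l x).length * (b.eval (sz α x + q.eval (sz α x) + bl.eval (sz α x) + 2) + 30) ≤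
    bl.eval (sz α x) * (b.eval (sz α x + q.eval (sz α x) + bl.eval (sz α x) + 2) + 30) :=
    Nat.mul_le_mul_right _ (by omega)
  simp only [Polynomial.eval_add, Polynomial.eval_mul, Polynomial.eval_comp, Polynomial.eval_X,
    Polynomial.eval_ofNat]
  omega

/-- A fold each of whose steps lengthens the state by a polynomial amount only. -/
theorem foldl_of_growth {l : X → List A} {s : X → S} {f : X → S → A → S} (hl : PolyTime op l)
    (hs : PolyTime op s) (hf : PolyTime op fun p : X × S × A => f p.1 p.2.1 p.2.2)
    (q : Polynomial ℕ)
    (hq : ∀ x s, ∀ a ∈ l x, sz α (f x s a) ≤ sz α s + q.eval (sz α x)) :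
    PolyTime op fun x => (l x).foldl (f x) (s x) := by
  obtain ⟨_, bl, hbl⟩ := _root_.id hl
  obtain ⟨_, bs, hbs⟩ := _root_.id hs
  refine foldl hl hs hf (bs + bl * q) fun x l₁ l₂ h => ?_
  have key : ∀ l₁ : List A, (∀ a ∈ l₁, a ∈ l x) → ∀ s,
      sz α (l₁.foldl (f x) s) ≤ sz α s + l₁.length * q.eval (sz α x) := by
    intro l₁
    induction l₁ with
    | nil => simp
    | cons a l₁ ih =>
      intro hm s
      have h1 := ih (fun a ha => hm a (List.mem_cons_of_mem _ ha)) (f x s a)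
      have h2 := hq x s a (hm a List.mem_cons_self)
      simp only [List.foldl_cons, List.length_cons, add_mul, one_mul]
      omega
  have h1 := key l₁ (by simp +contextual [h]) (s x)
  obtain ⟨t, _, ht⟩ := hbl x
  obtain ⟨t', _, ht'⟩ := hbs x
  have h2 := length_le_sz (α := α) (l x)
  have h3 : l₁.length ≤ (l x).length := by simp [h]
  have h4 : l₁.length * q.eval (sz α x) ≤ bl.eval (sz α x) * q.eval (sz α x) :=
    Nat.mul_le_mul_right _ (by omega)
  simp only [Polynomial.eval_add, Polynomial.eval_mul]
  omega

end PolyTime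

end Machine

/-! ### List operations and unary arithmetic in polynomial time -/

section Lists

variable {α ι : Type*} {op : ι → Data α → Data α}
variable {X Y Z S A B : Type*} [HasRep α X] [HasRep α Y] [HasRep α Z] [HasRep α S] [HasRep α A]
  [HasRep α B]

namespace PolyTime

/-- A polynomial bound for the length of the output. -/
theorem exists_sz_le {f : X → Y} (hf : PolyTime op f) :
    ∃ b : Polynomial ℕ, ∀ x, sz α (f x) ≤ b.eval (sz α x) := by
  obtain ⟨_, b, hb⟩ := hf
  refine ⟨b, fun x => ?_⟩
  obtain ⟨t, _, ht⟩ := hb x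
  omega

theorem reverse {l : X → List A} (hl : PolyTime op l) : PolyTime op fun x => (l x).reverse := by
  obtain ⟨b, hb⟩ := hl.exists_sz_le
  have := foldl_of_growth (f := fun _ s a => a :: s) hl (nil (Y := A))
    (cons id.snd.snd id.snd.fst) (b + 1) (fun x s a ha => by
      have := hb x
      have := sz_le_of_mem (α := α) ha
      simp only [sz_cons, Polynomial.eval_add, Polynomial.eval_one]; omega)
  simpa using this

theorem map {l : X → List A} {f : X → A → B} (hl : PolyTime op l)
    (hf : PolyTime op fun p : X × A => f p.1 p.2) : PolyTime op fun x => (l x).map (f x) := by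
  obtain ⟨b, hb⟩ := hl.exists_sz_le
  obtain ⟨d, hd⟩ := hf.exists_sz_le
  have := foldl_of_growth (f := fun x s a => f x a :: s) hl (nil (Y := B))
    (cons (hf.comp (id.fst.pair id.snd.snd)) id.snd.fst)
    (d.comp (Polynomial.X + b + 1) + 1) (fun x s a ha => by
      have h1 := hb x
      have h2 := sz_le_of_mem (α := α) ha
      have h3 : sz α (f x a) ≤ _ := (hd (x, a)).trans
        (eval_mono d (show _ ≤ sz α x + b.eval (sz α x) + 1 by simp only [sz_pair]; omega))
      simp only [sz_cons, Polynomial.eval_add, Polynomial.eval_one, Polynomial.eval_comp,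
        Polynomial.eval_X]
      omega)
  refine this.reverse.of_rep_eq fun x => ?_
  congr 1
  have : ∀ (l : List A) s, (l.foldl (fun s a => f x a :: s) s) = (l.map (f x)).reverse ++ s := by
    intro l
    induction l with
    | nil => simp
    | cons a l ih => intro s; simp [ih]
  simp [this]

theorem append {f g : X → List A} (hf : PolyTime op f) (hg : PolyTime op g) :
    PolyTime op fun x => f x ++ g x := by
  obtain ⟨b, hb⟩ := hf.reverse.exists_sz_le
  have := foldl_of_growth (f := fun _ s a => a :: s) hf.reverse hg
    (cons id.snd.snd id.snd.fst) (b + 1) (fun x s a ha => by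
      have := hb x
      have := sz_le_of_mem (α := α) ha
      simp only [sz_cons, Polynomial.eval_add, Polynomial.eval_one]; omega)
  refine this.of_rep_eq fun x => ?_
  congr 1
  have : ∀ (l s : List A), (l.foldl (fun s a => a :: s) s) = l.reverse ++ s := by
    intro l
    induction l with
    | nil => simp
    | cons a l ih => intro s; simp [ih]
  simp [this]

theorem flatten {l : X → List (List A)} (hl : PolyTime op l) :
    PolyTime op fun x => (l x).flatten := by
  obtain ⟨b, hb⟩ := hl.exists_sz_le
  have := foldl_of_growth (f := fun _ s a => s ++ a) hl (nil (Y := A))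
    (append id.snd.fst id.snd.snd) b (fun x s a ha => by
      have := hb x
      have := sz_le_of_mem (α := α) ha
      have := sz_append (α := α) s a
      omega)
  refine this.of_rep_eq fun x => ?_
  congr 1
  have : ∀ (l : List (List A)) s, (l.foldl (fun s a => s ++ a) s) = s ++ l.flatten := by
    intro l
    induction l with
    | nil => simp
    | cons a l ih => intro s; simp [ih]
  simp [this]

theorem flatMap {l : X → List A} {f : X → A → List B} (hl : PolyTime op l)
    (hf : PolyTime op fun p : X × A => f p.1 p.2) : PolyTime op fun x => (l x).flatMap (f x) :=
  (map hl hf).flatten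

theorem filter {l : X → List A} {f : X → A → Bool} (hl : PolyTime op l)
    (hf : PolyTime op fun p : X × A => f p.1 p.2) : PolyTime op fun x => (l x).filter (f x) := by
  refine (flatMap (f := fun x a => bif f x a then [a] else []) hl
    (cond hf (cons id.snd nil) nil)).of_rep_eq fun x => ?_
  congr 1
  induction l x with
  | nil => rfl
  | cons a l ih => cases h : f x a <;> simp [h, ih]

theorem all {l : X → List A} {f : X → A → Bool} (hl : PolyTime op l)
    (hf : PolyTime op fun p : X × A => f p.1 p.2) : PolyTime op fun x => (l x).all (f x) := by
  refine (filter (f := fun x a => !f x a) hl hf.not).isEmpty.of_rep_eq fun x => ?_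
  congr 1
  induction l x with
  | nil => rfl
  | cons a l ih => cases h : f x a <;> simp [h, ih]

theorem any {l : X → List A} {f : X → A → Bool} (hl : PolyTime op l)
    (hf : PolyTime op fun p : X × A => f p.1 p.2) : PolyTime op fun x => (l x).any (f x) := by
  refine (filter hl hf).isEmpty.not.of_rep_eq fun x => ?_
  congr 1
  induction l x with
  | nil => rfl
  | cons a l ih => cases h : f x a <;> simp [h, ih]

/-- A unary numeral and the list of that many units are the same tree. Arithmetic thereby reduces to
list operations: sums are concatenations and differences are `drop`s. -/
theorem replicate {f : X → ℕ} (hf : PolyTime op f) :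
    PolyTime op fun x => List.replicate (f x) () :=
  hf.of_rep_eq fun x => by
    induction f x with
    | zero => rfl
    | succ n ih => rw [List.replicate_succ, rep_cons, ← ih]; rfl

theorem length {l : X → List A} (hl : PolyTime op l) : PolyTime op fun x => (l x).length := by
  refine (map (f := fun _ _ => ()) hl unit).of_rep_eq fun x => ?_
  induction l x with
  | nil => rfl
  | cons a l ih => rw [List.map_cons, rep_cons, ih]; rfl

theorem sum {l : X → List ℕ} (hl : PolyTime op l) : PolyTime op fun x => (l x).sum := by
  refine (flatMap (f := fun _ n => List.replicate n ()) hl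
    (replicate id.snd)).length.of_rep_eq fun x => ?_
  congr 1
  induction l x with
  | nil => rfl
  | cons a l ih => simp_all

theorem mul {f g : X → ℕ} (hf : PolyTime op f) (hg : PolyTime op g) :
    PolyTime op fun x => f x * g x := by
  refine (map (f := fun x _ => g x) hf.replicate (hg.comp id.fst)).sum.of_rep_eq fun x => ?_
  simp

theorem drop {l : X → List A} {f : X → ℕ} (hl : PolyTime op l) (hf : PolyTime op f) :
    PolyTime op fun x => (l x).drop (f x) := by
  have htail : ∀ s : List A, sz α s.tail ≤ sz α s := fun s => by
    cases s
    · simp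
    · simp only [List.tail_cons, sz_cons]; omega
  refine (foldl_of_growth (f := fun _ s (_ : Unit) => s.tail) hf.replicate hl id.snd.fst.tail 0
    (fun x s a ha => by simpa using htail s)).of_rep_eq fun x => ?_
  congr 1
  have : ∀ n (l : List A), (List.replicate n ()).foldl (fun s _ => s.tail) l = l.drop n := by
    intro n
    induction n with
    | zero => simp
    | succ n ih => intro l; rw [List.replicate_succ, List.foldl_cons, ih]; simp
  exact this _ _

theorem sub {f g : X → ℕ} (hf : PolyTime op f) (hg : PolyTime op g) :
    PolyTime op fun x => f x - g x := by
  refine (drop hf.replicate hg).length.of_rep_eq fun x => ?_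
  simp

theorem le {f g : X → ℕ} (hf : PolyTime op f) (hg : PolyTime op g) :
    PolyTime op fun x => decide (f x ≤ g x) :=
  (sub hf hg).isZero.of_rep_eq fun x => by simp [Nat.sub_eq_zero_iff_le]

theorem eq {f g : X → ℕ} (hf : PolyTime op f) (hg : PolyTime op g) :
    PolyTime op fun x => decide (f x = g x) :=
  (and (le hf hg) (le hg hf)).of_rep_eq fun x => by
    rw [← Bool.decide_and]; congr 2; exact propext (by omega)

theorem mem {f : X → ℕ} {l : X → List ℕ} (hf : PolyTime op f) (hl : PolyTime op l) :
    PolyTime op fun x => decide (f x ∈ l x) := by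
  refine (any (f := fun x a => decide (f x = a)) hl (eq (hf.comp id.fst) id.snd)).of_rep_eq
    fun x => ?_
  congr 1
  rw [Bool.eq_iff_iff]
  simp

theorem range {f : X → ℕ} (hf : PolyTime op f) : PolyTime op fun x => List.range (f x) := by
  obtain ⟨b, hb⟩ := hf.exists_sz_le
  have key : ∀ l : List Unit,
      l.foldl (fun (s : List ℕ) _ => s.length :: s) [] = (List.range l.length).reverse := by
    intro l
    induction l using List.reverseRecOn with
    | nil => rfl
    | append_singleton l a ih =>
      simp only [List.foldl_append, ih, List.foldl_cons, List.foldl_nil, List.length_append,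
        List.length_singleton, List.range_succ, List.reverse_append, List.length_reverse,
        List.length_range]
      rfl
  refine (foldl (f := fun _ (s : List ℕ) (_ : Unit) => s.length :: s) hf.replicate
    (nil (Y := ℕ)) (cons id.snd.fst.length id.snd.fst) (b * (2 * b + 2) + 1) ?_).reverse.of_rep_eq
    fun x => ?_
  · intro x l₁ l₂ h
    have h1 : l₁.length ≤ f x := by
      have := congrArg List.length h
      simp at this; omega
    have h2 := hb x
    rw [sz_nat] at h2
    rw [key]
    refine (sz_le_of_forall_le _ (2 * b.eval (sz α x) + 1) fun a ha => ?_).trans ?_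
    · simp at ha
      rw [sz_nat]; omega
    · simp only [List.length_reverse, List.length_range, Polynomial.eval_add,
        Polynomial.eval_mul, Polynomial.eval_ofNat, Polynomial.eval_one]
      exact Nat.add_le_add_right (Nat.mul_le_mul (by omega) (by omega)) 1
  · rw [key]; simp

theorem getD {l : X → List A} {f : X → ℕ} {g : X → A} (hl : PolyTime op l) (hf : PolyTime op f)
    (hg : PolyTime op g) : PolyTime op fun x => (l x).getD (f x) (g x) := by
  refine (headD (drop hl hf) hg).of_rep_eq fun x => ?_
  congr 1
  simp [List.headD_eq_head?_getD]

end PolyTime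

end Lists

/-! ### The greedy algorithm -/

/-- A candidate: the indices of its terminals, and codes of points which connect them. -/
abbrev Cand (α : Type*) := List ℕ × List (Data α)

/-- Give all indices in `T` the same label. -/
def mergeLabels (lab T : List ℕ) : List ℕ :=
  lab.map fun a => bif decide (a ∈ T.map fun i => lab.getD i 0) then
    (T.map fun i => lab.getD i 0).headD 0 else a

/-- Labels of the connected components of the hypergraph `H` on `0, …, n - 1`. -/
def labels (n : ℕ) (H : List (List ℕ)) : List ℕ := H.foldl mergeLabels (List.range n)

/-- The number of connected components of the hypergraph `H` on `0, …, n - 1`. -/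
def numLabels (n : ℕ) (H : List (List ℕ)) : ℕ :=
  ((List.range n).filter fun a => decide (a ∈ labels n H)).length

section

variable {α : Type*}

/-- The terminal sets of the candidates of cost at most `t`. -/
def layer (cands : List (Cand α)) (t : ℕ) : List (List ℕ) :=
  (cands.filter fun e => decide (e.2.length ≤ t)).map fun e => e.1

/-- A number larger than all costs. -/
def height (cands : List (Cand α)) : ℕ := (cands.map fun e => e.2.length).sum + 1

/-- The cost of completing `H` by a minimum spanning tree, summed over the layers. -/
def excess (n : ℕ) (cands H : List (Cand α)) : ℕ :=
  ((List.range (height cands)).map fun t =>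
    numLabels n (H.map (fun e => e.1) ++ layer cands t) - 1).sum

/-- What is saved in the excess by choosing `e`. -/
def gain (n : ℕ) (cands H : List (Cand α)) (e : Cand α) : ℕ :=
  excess n cands H - excess n cands (e :: H)

/-- The candidates of positive gain with the best ratio of cost to gain. -/
def best (n : ℕ) (cands H : List (Cand α)) : List (Cand α) :=
  cands.filter fun e => !decide (gain n cands H e = 0) && cands.all fun e' =>
    decide (e.2.length * gain n cands H e' ≤ e'.2.length * gain n cands H e)

/-- One step of the greedy algorithm. -/
def greedyStep (n : ℕ) (cands H : List (Cand α)) : List (Cand α) :=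
  bif (best n cands H).isEmpty then H else (best n cands H).headD ([], []) :: H

/-- The candidates chosen by the greedy algorithm. -/
def greedy (n : ℕ) (cands : List (Cand α)) : List (Cand α) :=
  (List.replicate (excess n cands []) ()).foldl (fun H _ => greedyStep n cands H) []

/-- Codes of the points of the greedy solution. -/
def greedySolution (n : ℕ) (cands : List (Cand α)) : List (Data α) :=
  (greedy n cands).flatMap fun e => e.2

/-- The sublists of length at most `k`. -/
def shortSublists {A : Type*} : ℕ → List A → List (List A)
  | 0, _ => [[]]
  | k + 1, l => [] :: (List.range l.length).flatMap fun i =>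
      (shortSublists k (l.drop (i + 1))).flatMap fun s => ((l.drop i).take 1).map fun a => a :: s

theorem length_mergeLabels (lab T : List ℕ) : (mergeLabels lab T).length = lab.length := by
  simp [mergeLabels]

theorem length_labels (n : ℕ) (H : List (List ℕ)) : (labels n H).length = n := by
  have : ∀ (H : List (List ℕ)) lab, (H.foldl mergeLabels lab).length = lab.length := by
    intro H
    induction H with
    | nil => simp
    | cons T H ih => intro lab; rw [List.foldl_cons, ih, length_mergeLabels]
  rw [labels, this, List.length_range]

theorem le_of_mem_mergeLabels {m : ℕ} {lab T : List ℕ} (h : ∀ a ∈ lab, a ≤ m) :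
    ∀ a ∈ mergeLabels lab T, a ≤ m := by
  have hg : ∀ i, lab.getD i 0 ≤ m := fun i => by
    rw [List.getD_eq_getElem?_getD]
    cases hi : lab[i]? with
    | none => simp
    | some b => exact h b (List.mem_of_getElem? hi)
  intro a ha
  obtain ⟨b, hb, rfl⟩ := List.mem_map.1 ha
  cases hd : decide (b ∈ T.map fun i => lab.getD i 0) with
  | false => exact h b hb
  | true =>
    cases T with
    | nil => simp
    | cons i T => exact hg i

theorem le_of_mem_labels {n : ℕ} {H : List (List ℕ)} : ∀ a ∈ labels n H, a ≤ n - 1 := by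
  have : ∀ (H : List (List ℕ)) lab, (∀ a ∈ lab, a ≤ n - 1) →
      ∀ a ∈ H.foldl mergeLabels lab, a ≤ n - 1 := by
    intro H
    induction H with
    | nil => simp
    | cons T H ih => intro lab h; exact ih _ (le_of_mem_mergeLabels h)
  exact this H _ fun a ha => Nat.le_sub_one_of_lt (List.mem_range.1 ha)

end

/-! ### The greedy algorithm runs in polynomial time -/

section PolyTime

variable {α ι : Type*} {op : ι → Data α → Data α} {X A : Type*} [HasRep α X] [HasRep α A]

namespace PolyTime

theorem mergeLabels {lab T : X → List ℕ} (hl : PolyTime op lab) (hT : PolyTime op T) :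
    PolyTime op fun x => mergeLabels (lab x) (T x) := by
  have h : PolyTime op fun x => (T x).map fun i => (lab x).getD i 0 :=
    map hT (getD (hl.comp id.fst) id.snd zero)
  exact map hl (cond (mem id.snd (h.comp id.fst)) (headD (h.comp id.fst) zero) id.snd)

/-- Intermediate states stay small because a label list always has `n` entries, each at most `n -
1`. -/
theorem labels {n : X → ℕ} {H : X → List (List ℕ)} (hn : PolyTime op n) (hH : PolyTime op H) :
    PolyTime op fun x => labels (n x) (H x) := by
  obtain ⟨b, hb⟩ := hn.exists_sz_le
  refine foldl (f := fun _ => STMSP.mergeLabels) hH hn.range (mergeLabels id.snd.fst id.snd.snd)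
    (b * (2 * b + 2) + 1) fun x l₁ l₂ _ => ?_
  have h1 := hb x
  rw [sz_nat] at h1
  refine (sz_le_of_forall_le _ (2 * b.eval (sz α x) + 1) fun a ha => ?_).trans ?_
  · have := le_of_mem_labels (n := n x) (H := l₁) a ha
    rw [sz_nat]; omega
  · have := length_labels (n x) l₁
    rw [STMSP.labels] at this
    rw [this]
    simp only [Polynomial.eval_add, Polynomial.eval_mul, Polynomial.eval_ofNat,
      Polynomial.eval_one]
    exact Nat.add_le_add_right (Nat.mul_le_mul (by omega) (by omega)) 1

theorem numLabels {n : X → ℕ} {H : X → List (List ℕ)} (hn : PolyTime op n) (hH : PolyTime op H) :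
    PolyTime op fun x => numLabels (n x) (H x) :=
  (filter hn.range (mem id.snd ((labels hn hH).comp id.fst))).length

variable {n : X → ℕ} {cands H : X → List (Cand α)} {e : X → Cand α}

theorem layer {t : X → ℕ} (hc : PolyTime op cands) (ht : PolyTime op t) :
    PolyTime op fun x => layer (cands x) (t x) :=
  map (filter hc (le id.snd.snd.length (ht.comp id.fst))) id.snd.fst

theorem height (hc : PolyTime op cands) : PolyTime op fun x => height (cands x) :=
  (map hc id.snd.snd.length).sum.succ

theorem excess (hn : PolyTime op n) (hc : PolyTime op cands) (hH : PolyTime op H) :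
    PolyTime op fun x => excess (n x) (cands x) (H x) :=
  (map hc.height.range (numLabels (hn.comp id.fst)
    (append ((map (f := fun _ e => e.1) hH id.snd.fst).comp id.fst) (layer (hc.comp id.fst) id.snd))).pred).sum

theorem gain (hn : PolyTime op n) (hc : PolyTime op cands) (hH : PolyTime op H)
    (he : PolyTime op e) : PolyTime op fun x => gain (n x) (cands x) (H x) (e x) :=
  sub (excess hn hc hH) (excess hn hc (cons he hH))

theorem best (hn : PolyTime op n) (hc : PolyTime op cands) (hH : PolyTime op H) :
    PolyTime op fun x => best (n x) (cands x) (H x) := by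
  have hg : PolyTime op fun p : X × Cand α => STMSP.gain (n p.1) (cands p.1) (H p.1) p.2 :=
    gain (hn.comp id.fst) (hc.comp id.fst) (hH.comp id.fst) id.snd
  exact filter hc (and hg.isZero.not (all (hc.comp id.fst)
    (le (mul id.fst.snd.snd.length (hg.comp (id.fst.fst.pair id.snd)))
      (mul id.snd.snd.length (hg.comp id.fst)))))

theorem greedyStep (hn : PolyTime op n) (hc : PolyTime op cands) (hH : PolyTime op H) :
    PolyTime op fun x => greedyStep (n x) (cands x) (H x) :=
  cond (best hn hc hH).isEmpty hH (cons (headD (best hn hc hH) (pair nil nil)) hH)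

theorem greedy (hn : PolyTime op n) (hc : PolyTime op cands) :
    PolyTime op fun x => greedy (n x) (cands x) := by
  obtain ⟨b, hb⟩ := hc.exists_sz_le
  refine foldl_of_growth (f := fun x H _ => STMSP.greedyStep (n x) (cands x) H)
    (excess hn hc nil).replicate nil
    (greedyStep (hn.comp id.fst) (hc.comp id.fst) id.snd.fst) (b + 4) fun x H _ _ => ?_
  have h1 := hb x
  simp only [STMSP.greedyStep, Polynomial.eval_add, Polynomial.eval_ofNat]
  cases h : STMSP.best (n x) (cands x) H with
  | nil => simp
  | cons e l =>
    have he : e ∈ cands x := List.mem_of_mem_filter (h ▸ List.mem_cons_self :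
      e ∈ STMSP.best (n x) (cands x) H)
    have := sz_le_of_mem (α := α) he
    simp only [List.isEmpty_cons, cond_false, List.headD_cons, sz_cons]
    omega

theorem greedySolution (hn : PolyTime op n) (hc : PolyTime op cands) :
    PolyTime op fun x => greedySolution (n x) (cands x) :=
  flatMap (greedy hn hc) id.snd.snd

theorem take_one {l : X → List A} (hl : PolyTime op l) : PolyTime op fun x => (l x).take 1 := by
  refine (cond hl.isEmpty nil (cons (first.comp hl.data) nil)).of_rep_eq fun x => ?_
  cases l x <;> simp [Data.first]

/-- The recursion on `k` unfolds into the program, whose size depends on the constant `k`. The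
context type is generalized because the recursive call runs inside a map whose context also carries
the position `i`. -/
theorem shortSublists (k : ℕ) : ∀ {X : Type _} [HasRep α X] {l : X → List A},
    PolyTime op l → PolyTime op fun x => shortSublists k (l x) := by
  induction k with
  | zero => exact fun _ => cons nil nil
  | succ k ih =>
    intro X _ l hl
    exact cons nil (flatMap hl.length.range (flatMap
      (ih (drop (hl.comp id.fst) id.snd.succ))
      (map (take_one (drop (hl.comp id.fst.fst) id.fst.snd)) (cons id.snd id.fst.snd))))

end PolyTime

end PolyTime

section ShortSublists

variable {A : Type*}

theorem mem_shortSublists {k : ℕ} {l s : List A} :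
    s ∈ shortSublists k l ↔ s.Sublist l ∧ s.length ≤ k := by
  induction k generalizing l s with
  | zero => simp +contextual [shortSublists]
  | succ k ih =>
    simp only [shortSublists, List.mem_cons, List.mem_flatMap, List.mem_range, List.mem_map, ih]
    constructor
    · rintro (rfl | ⟨i, hi, s, ⟨hs, hk⟩, a, ha, rfl⟩)
      · simp
      · have ha' : a = l[i] := by
          rw [List.drop_eq_getElem_cons hi, List.take_succ_cons, List.take_zero] at ha
          exact List.mem_singleton.1 ha
        refine ⟨?_, by simpa using hk⟩
        refine List.Sublist.trans ?_ (List.drop_sublist i l)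
        rw [List.drop_eq_getElem_cons hi, ← ha']
        exact hs.cons_cons _
    · rintro ⟨hs, hk⟩
      rcases s with _ | ⟨a, s⟩
      · exact Or.inl rfl
      · right
        obtain ⟨r₁, r₂, rfl, ha, hs'⟩ := List.cons_sublist_iff.1 hs
        obtain ⟨u, v, rfl⟩ := List.append_of_mem ha
        refine ⟨u.length, by simp, s, ⟨?_, by simpa using hk⟩, a, ?_, rfl⟩
        · refine hs'.trans ?_
          simp [List.drop_append]
        · simp

end ShortSublists

/-! ### Analysis of the greedy algorithm -/

/-- If `f` determines `g` on `s`, then `g` takes no more values than `f`. Component counts are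
compared throughout in this form, without quotients. -/
theorem card_image_le_of_forall {A B C : Type*} [DecidableEq B] [DecidableEq C] (s : Finset A)
    (f : A → B) (g : A → C) (h : ∀ i ∈ s, ∀ j ∈ s, f i = f j → g i = g j) :
    (s.image g).card ≤ (s.image f).card := by
  classical
  rcases s.eq_empty_or_nonempty with rfl | ⟨a, _⟩
  · simp
  have : Nonempty A := ⟨a⟩
  have hc : ∀ b ∈ s.image f, ∃ i ∈ s, f i = b := fun b hb => Finset.mem_image.1 hb
  choose! c hc1 hc2 using hc
  refine (Finset.card_le_card (t := (s.image f).image fun b => g (c b)) ?_).trans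
    Finset.card_image_le
  intro x hx
  obtain ⟨i, hi, rfl⟩ := Finset.mem_image.1 hx
  have hi' := Finset.mem_image_of_mem f hi
  exact Finset.mem_image.2 ⟨f i, hi', h _ (hc1 _ hi') _ hi (hc2 _ hi')⟩

/-- The label of the index `i`. -/
def label (n : ℕ) (H : List (List ℕ)) (i : ℕ) : ℕ := (labels n H).getD i 0

theorem getD_mergeLabels {lab T : List ℕ} {i : ℕ} (hi : i < lab.length) :
    (mergeLabels lab T).getD i 0 = if lab.getD i 0 ∈ T.map (fun i => lab.getD i 0) then
      (T.map fun i => lab.getD i 0).headD 0 else lab.getD i 0 := by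
  rw [mergeLabels, List.getD_eq_getElem _ _ (by simpa using hi), List.getElem_map,
    List.getD_eq_getElem (l := lab) _ hi]
  split_ifs with h <;> simp only [h, decide_true, decide_false, cond_true, cond_false]

theorem labels_append_singleton (n : ℕ) (H : List (List ℕ)) (T : List ℕ) :
    labels n (H ++ [T]) = mergeLabels (labels n H) T := by
  simp [labels]

theorem label_append_singleton {n : ℕ} (H : List (List ℕ)) (T : List ℕ) {i : ℕ} (hi : i < n) :
    label n (H ++ [T]) i = if label n H i ∈ T.map (label n H) then
      (T.map (label n H)).headD 0 else label n H i := by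
  rw [label, labels_append_singleton, getD_mergeLabels (by rwa [length_labels])]
  rfl

theorem label_nil {n i : ℕ} (hi : i < n) : label n [] i = i := by
  simp [label, labels, hi]

theorem label_eq_of_mem {n : ℕ} {H : List (List ℕ)} (hH : ∀ T ∈ H, ∀ i ∈ T, i < n)
    {T : List ℕ} (hT : T ∈ H) {i j : ℕ} (hi : i ∈ T) (hj : j ∈ T) :
    label n H i = label n H j := by
  induction H using List.reverseRecOn with
  | nil => simp at hT
  | append_singleton H U ih =>
    have hin := hH T hT i hi
    have hjn := hH T hT j hj
    rw [label_append_singleton H U hin, label_append_singleton H U hjn]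
    rcases List.mem_append.1 hT with hT | hT
    · rw [ih (fun T hT => hH T (List.mem_append_left _ hT)) hT]
    · rw [List.mem_singleton.1 hT] at hi hj
      rw [if_pos (List.mem_map_of_mem hi), if_pos (List.mem_map_of_mem hj)]

/-- Together with `label_eq_of_mem` this is the universal property of components: labels are
constant on hyperedges, and every function constant on hyperedges factors through the labels. Later
arguments use only these two facts and the effect of adding one hyperedge. -/
theorem eq_of_label_eq {B : Type*} {n : ℕ} {H : List (List ℕ)} (hH : ∀ T ∈ H, ∀ i ∈ T, i < n)
    (φ : ℕ → B) (hφ : ∀ T ∈ H, ∀ i ∈ T, ∀ j ∈ T, φ i = φ j) {i j : ℕ} (hi : i < n) (hj : j < n)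
    (h : label n H i = label n H j) : φ i = φ j := by
  induction H using List.reverseRecOn generalizing i j with
  | nil => rw [label_nil hi, label_nil hj] at h; rw [h]
  | append_singleton H T ih =>
    have ih' := @ih (fun T hT => hH T (List.mem_append_left _ hT))
      (fun T hT => hφ T (List.mem_append_left _ hT))
    have hTn : ∀ a ∈ T, a < n := hH T (by simp)
    have hTφ := hφ T (by simp)
    have head : ∀ k, label n H k ∈ T.map (label n H) →
        (T.map (label n H)).headD 0 ∈ T.map (label n H) := by
      intro k hk
      cases T with
      | nil => simp at hk
      | cons a T => simp
    rw [label_append_singleton H T hi, label_append_singleton H T hj] at h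
    split_ifs at h with h1 h2 h2
    · obtain ⟨a, ha, ha'⟩ := List.mem_map.1 h1
      obtain ⟨b, hb, hb'⟩ := List.mem_map.1 h2
      rw [← ih' (hTn a ha) hi ha', ← ih' (hTn b hb) hj hb', hTφ a ha b hb]
    · exact absurd (h ▸ head i h1) h2
    · exact absurd (h ▸ head j h2) h1
    · exact ih' hi hj h

theorem numLabels_eq (n : ℕ) (H : List (List ℕ)) :
    numLabels n H = ((Finset.range n).image (label n H)).card := by
  have h : (Finset.range n).image (label n H) =
      ((List.range n).filter fun a => decide (a ∈ labels n H)).toFinset := by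
    ext a
    simp only [Finset.mem_image, Finset.mem_range, List.mem_toFinset, List.mem_filter,
      List.mem_range, decide_eq_true_eq, label]
    constructor
    · rintro ⟨i, hi, rfl⟩
      have hi' : i < (labels n H).length := by rwa [length_labels]
      have hm : (labels n H).getD i 0 ∈ labels n H := by
        rw [List.getD_eq_getElem _ _ hi']; exact List.getElem_mem _
      have := le_of_mem_labels _ hm
      exact ⟨by omega, hm⟩
    · rintro ⟨_, ha⟩
      obtain ⟨i, hi, rfl⟩ := List.getElem_of_mem ha
      exact ⟨i, by rwa [length_labels] at hi, List.getD_eq_getElem _ _ hi⟩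
  rw [h, List.toFinset_card_of_nodup ((List.nodup_range).filter _), numLabels]

theorem numLabels_le_of_coarser {B : Type*} [DecidableEq B] {n : ℕ} {H : List (List ℕ)}
    (hH : ∀ T ∈ H, ∀ i ∈ T, i < n) (φ : ℕ → B) (hφ : ∀ T ∈ H, ∀ i ∈ T, ∀ j ∈ T, φ i = φ j) :
    ((Finset.range n).image φ).card ≤ numLabels n H := by
  rw [numLabels_eq]
  exact card_image_le_of_forall _ _ _ fun i hi j hj h =>
    eq_of_label_eq hH φ hφ (Finset.mem_range.1 hi) (Finset.mem_range.1 hj) h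

theorem numLabels_anti {n : ℕ} {H H' : List (List ℕ)} (hH' : ∀ T ∈ H', ∀ i ∈ T, i < n)
    (h : H ⊆ H') : numLabels n H' ≤ numLabels n H := by
  rw [numLabels_eq n H']
  exact numLabels_le_of_coarser (fun T hT => hH' T (h hT)) _ fun T hT i hi j hj =>
    label_eq_of_mem hH' (h hT) hi hj

theorem numLabels_congr {n : ℕ} {H H' : List (List ℕ)} (hH' : ∀ T ∈ H', ∀ i ∈ T, i < n)
    (h : ∀ T, T ∈ H ↔ T ∈ H') : numLabels n H = numLabels n H' :=
  le_antisymm (numLabels_anti (fun T hT => hH' T ((h T).1 hT)) fun T hT => (h T).2 hT)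
    (numLabels_anti hH' fun T hT => (h T).1 hT)

theorem one_le_numLabels {n : ℕ} (hn : 0 < n) (H : List (List ℕ)) : 1 ≤ numLabels n H := by
  rw [numLabels_eq, Nat.one_le_iff_ne_zero, Finset.card_ne_zero]
  exact (Finset.nonempty_range_iff.2 hn.ne').image _

/-- The number of components which meet `T`. -/
def hits (n : ℕ) (H : List (List ℕ)) (T : List ℕ) : ℕ := (T.toFinset.image (label n H)).card

theorem hits_anti {n : ℕ} {H H' : List (List ℕ)} (hH' : ∀ T ∈ H', ∀ i ∈ T, i < n)
    (h : H ⊆ H') {T : List ℕ} (hT : ∀ i ∈ T, i < n) : hits n H' T ≤ hits n H T :=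
  card_image_le_of_forall _ _ _ fun i hi j hj hij =>
    eq_of_label_eq (fun T hT => hH' T (h hT)) _
      (fun T hT i hi j hj => label_eq_of_mem hH' (h hT) hi hj)
      (hT i (by simpa using hi)) (hT j (by simpa using hj)) hij

theorem numLabels_append_singleton {n : ℕ} {H : List (List ℕ)} {T : List ℕ}
    (hT : ∀ i ∈ T, i < n) :
    numLabels n (H ++ [T]) + (hits n H T - 1) = numLabels n H := by
  rw [numLabels_eq, numLabels_eq]
  cases T with
  | nil =>
    simp only [hits, List.toFinset_nil, Finset.image_empty, Finset.card_empty, Nat.zero_sub,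
      add_zero]
    congr 1
    refine Finset.image_congr fun i hi => ?_
    rw [label_append_singleton H [] (by simpa using hi)]
    simp
  | cons a T =>
    set P := (Finset.range n).image (label n H) with hP
    set Q := (a :: T).toFinset.image (label n H) with hQ
    have hmem : ∀ x, x ∈ (a :: T).map (label n H) ↔ x ∈ Q := by
      intro x; simp [hQ]
    have hQP : Q ⊆ P := by
      refine Finset.image_subset_image fun i hi => ?_
      exact Finset.mem_range.2 (hT i (List.mem_toFinset.1 hi))
    have haQ : label n H a ∈ Q := by simp [hQ]
    -- The labels met by `a :: T` collapse into that of `a`, and the others survive, so exactly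
    -- `Q.card - 1` labels are lost.
    have him : (Finset.range n).image (label n (H ++ [a :: T])) = insert (label n H a) (P \ Q) := by
      ext x
      simp only [Finset.mem_image, Finset.mem_range, Finset.mem_insert, Finset.mem_sdiff]
      constructor
      · rintro ⟨i, hi, rfl⟩
        rw [label_append_singleton H _ hi]
        split_ifs with h
        · left; simp
        · right
          exact ⟨Finset.mem_image_of_mem _ (Finset.mem_range.2 hi), fun h' => h ((hmem _).2 h')⟩
      · rintro (rfl | ⟨h1, h2⟩)
        · refine ⟨a, hT a (by simp), ?_⟩
          rw [label_append_singleton H _ (hT a (by simp)), if_pos (by simp)]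
          simp
        · obtain ⟨i, hi, rfl⟩ := Finset.mem_image.1 h1
          refine ⟨i, Finset.mem_range.1 hi, ?_⟩
          rw [label_append_singleton H _ (Finset.mem_range.1 hi), if_neg fun h' => h2 ((hmem _).1 h')]
    have h1 : hits n H (a :: T) = Q.card := rfl
    have h2 : 1 ≤ Q.card := Finset.card_pos.2 ⟨_, haQ⟩
    have h3 := Finset.card_le_card hQP
    rw [him, Finset.card_insert_of_notMem (by simp [haQ]), Finset.card_sdiff_of_subset hQP, h1]
    omega

theorem numLabels_cons {n : ℕ} {H : List (List ℕ)} {T : List ℕ} (hH : ∀ T ∈ H, ∀ i ∈ T, i < n)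
    (hT : ∀ i ∈ T, i < n) : numLabels n (T :: H) + (hits n H T - 1) = numLabels n H := by
  rw [← numLabels_append_singleton (H := H) hT, numLabels_congr (H' := H ++ [T])]
  · intro U hU
    rcases List.mem_append.1 hU with hU | hU
    · exact hH U hU
    · rw [List.mem_singleton.1 hU]; exact hT
  · intro U; simp; tauto

/-- Submodularity: adding `T` removes `hits - 1` components, and by `hits_anti` it removes no more
after `G` has been added than before. The drops along `G` are therefore bounded by the drops of the
single hyperedges at `H`. -/
theorem numLabels_le_add_sum {n : ℕ} {H G : List (List ℕ)} (hH : ∀ T ∈ H, ∀ i ∈ T, i < n)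
    (hG : ∀ T ∈ G, ∀ i ∈ T, i < n) : numLabels n H ≤
      numLabels n (H ++ G) + (G.map fun T => numLabels n H - numLabels n (T :: H)).sum := by
  induction G using List.reverseRecOn with
  | nil => simp
  | append_singleton G T ih =>
    have hG' : ∀ T ∈ G, ∀ i ∈ T, i < n := fun T hT => hG T (List.mem_append_left _ hT)
    have hT : ∀ i ∈ T, i < n := hG T (by simp)
    have h1 := ih hG'
    have h2 := numLabels_append_singleton (H := H ++ G) hT
    have h3 := numLabels_cons hH hT
    have h4 := hits_anti (H := H) (H' := H ++ G) (fun U hU => by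
      rcases List.mem_append.1 hU with hU | hU
      exacts [hH U hU, hG' U hU]) (List.subset_append_left _ _) hT
    rw [List.map_append, List.sum_append, ← List.append_assoc]
    simp only [List.map_cons, List.map_nil, List.sum_cons, List.sum_nil]
    omega

/-! ### Excess, gain and the cost of the greedy choice -/

section

variable {α : Type*} {n : ℕ} {cands : List (Cand α)}

/-- The hyperedges of the layer `t` after the choice of `H`. -/
def layered (cands H : List (Cand α)) (t : ℕ) : List (List ℕ) :=
  H.map (fun e => e.1) ++ layer cands t

theorem excess_eq (n : ℕ) (cands H : List (Cand α)) : excess n cands H =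
    ((List.range (height cands)).map fun t => numLabels n (layered cands H t) - 1).sum := rfl

theorem mem_layer {t : ℕ} {T : List ℕ} :
    T ∈ layer cands t ↔ ∃ e ∈ cands, e.2.length ≤ t ∧ e.1 = T := by
  simp [layer, and_assoc]

theorem lt_of_mem_layered (hc : ∀ e ∈ cands, ∀ i ∈ e.1, i < n) {H : List (Cand α)}
    (hH : H ⊆ cands) (t : ℕ) : ∀ T ∈ layered cands H t, ∀ i ∈ T, i < n := by
  intro T hT
  rcases List.mem_append.1 hT with hT | hT
  · obtain ⟨e, he, rfl⟩ := List.mem_map.1 hT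
    exact hc e (hH he)
  · obtain ⟨e, he, _, rfl⟩ := mem_layer.1 hT
    exact hc e he

theorem layered_cons (H : List (Cand α)) (e : Cand α) (t : ℕ) :
    layered cands (e :: H) t = e.1 :: layered cands H t := rfl

theorem gain_eq (hc : ∀ e ∈ cands, ∀ i ∈ e.1, i < n) {H : List (Cand α)} (hH : H ⊆ cands)
    {e : Cand α} (he : e ∈ cands) : excess n cands (e :: H) + gain n cands H e =
      excess n cands H ∧ gain n cands H e = ((List.range (height cands)).map fun t =>
        numLabels n (layered cands H t) - numLabels n (e.1 :: layered cands H t)).sum := by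
  have key : excess n cands (e :: H) + ((List.range (height cands)).map fun t =>
      numLabels n (layered cands H t) - numLabels n (e.1 :: layered cands H t)).sum =
      excess n cands H := by
    rw [excess_eq, excess_eq, ← List.sum_map_add]
    congr 1
    refine List.map_congr_left fun t _ => ?_
    have h1 := lt_of_mem_layered hc hH t
    have h2 : numLabels n (e.1 :: layered cands H t) ≤ numLabels n (layered cands H t) :=
      numLabels_anti (by
        intro T hT
        rcases List.mem_cons.1 hT with rfl | hT
        exacts [hc e he, h1 T hT]) (List.subset_cons_self _ _)
    rcases Nat.eq_zero_or_pos n with rfl | hn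
    · simp [numLabels]
    · have := one_le_numLabels hn (e.1 :: layered cands H t)
      rw [layered_cons]
      omega
  constructor
  · rw [gain]; omega
  · rw [gain]; omega

theorem cost_lt_height {e : Cand α} (he : e ∈ cands) : e.2.length < height cands :=
  Nat.lt_succ_of_le (List.single_le_sum (by simp) _ (List.mem_map_of_mem (f := fun e => e.2.length) he))

theorem numLabels_le_one_of_subset {H : List (Cand α)}
    (hc : ∀ e ∈ cands, ∀ i ∈ e.1, i < n) {G : List (Cand α)} (hG : G ⊆ cands)
    (hG1 : numLabels n (G.map fun e => e.1) ≤ 1) (hH : H ⊆ cands) (t : ℕ) :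
    numLabels n (layered cands H t ++ G.map fun e => e.1) ≤ 1 := by
  refine (numLabels_anti (fun T hT => ?_) (List.subset_append_right _ _)).trans hG1
  rcases List.mem_append.1 hT with hT | hT
  · exact lt_of_mem_layered hc hH t T hT
  · obtain ⟨e, he, rfl⟩ := List.mem_map.1 hT
    exact hc e (hG he)

/-- Submodularity is applied in each layer separately and summed; adding all of `G` leaves at most
one component in every layer. -/
theorem excess_le_sum_gain (hc : ∀ e ∈ cands, ∀ i ∈ e.1, i < n) {H G : List (Cand α)}
    (hH : H ⊆ cands) (hG : G ⊆ cands) (hG1 : numLabels n (G.map fun e => e.1) ≤ 1) :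
    excess n cands H ≤ (G.map fun e => gain n cands H e).sum := by
  have h1 : (G.map fun e => gain n cands H e) = G.map fun e => ((List.range (height cands)).map
      fun t => numLabels n (layered cands H t) - numLabels n (e.1 :: layered cands H t)).sum :=
    List.map_congr_left fun e he => (gain_eq hc hH (hG he)).2
  have swap : ∀ (G : List (Cand α)) (L : List ℕ) (F : Cand α → ℕ → ℕ),
      (G.map fun e => (L.map fun t => F e t).sum).sum =
        (L.map fun t => (G.map fun e => F e t).sum).sum := by
    intro G L F
    induction G with
    | nil => simp
    | cons e G ih => simp [ih, List.sum_map_add]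
  rw [h1, swap, excess_eq]
  refine List.sum_le_sum fun t _ => ?_
  have h2 := numLabels_le_add_sum (lt_of_mem_layered hc hH t) (G := G.map fun e => e.1)
    (fun T hT => by
      obtain ⟨e, he, rfl⟩ := List.mem_map.1 hT
      exact hc e (hG he))
  have h3 := numLabels_le_one_of_subset hc hG hG1 hH t
  rw [List.map_map] at h2
  simp only [Function.comp_def] at h2
  omega

theorem excess_pos_iff {H : List (Cand α)} :
    0 < excess n cands H ↔ ∃ t < height cands, 1 < numLabels n (layered cands H t) := by
  rw [Nat.pos_iff_ne_zero, Ne, excess_eq, List.sum_eq_zero_iff]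
  simp only [List.mem_map, List.mem_range, forall_exists_index, and_imp, forall_apply_eq_imp_iff₂]
  push Not
  simp only [ne_eq, Nat.sub_eq_zero_iff_le, not_le]

theorem card_image_le_one_iff {A B : Type*} [DecidableEq B] {s : Finset A} {f : A → B} :
    (s.image f).card ≤ 1 ↔ ∀ i ∈ s, ∀ j ∈ s, f i = f j := by
  rw [Finset.card_le_one]
  simp

/-- Take a cheapest candidate `e` that meets two components of layer `0`. For `t < e.2.length`, the
candidates of layer `t` are cheaper than `e` and so join nothing new; layer `t` has the components
of layer `0`, and `e` saves at least one component there. This happens in as many layers as `e` has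
points. -/
theorem exists_cost_le_gain (hc : ∀ e ∈ cands, ∀ i ∈ e.1, i < n) {H G : List (Cand α)}
    (hH : H ⊆ cands) (hG : G ⊆ cands) (hG1 : numLabels n (G.map fun e => e.1) ≤ 1)
    (hpos : 0 < excess n cands H) :
    ∃ e ∈ cands, 0 < gain n cands H e ∧ e.2.length ≤ gain n cands H e := by
  classical
  have hl := fun t => lt_of_mem_layered hc hH t
  obtain ⟨t, ht, h1⟩ := excess_pos_iff.1 hpos
  have h0 : 1 < numLabels n (layered cands H 0) := by
    refine h1.trans_le (numLabels_anti (hl t) ?_)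
    intro T hT
    rcases List.mem_append.1 hT with hT | hT
    · exact List.mem_append_left _ hT
    · obtain ⟨e, he, hle, rfl⟩ := mem_layer.1 hT
      exact List.mem_append_right _ (mem_layer.2 ⟨e, he, by omega, rfl⟩)
  -- Otherwise the labels of layer `0` are constant on every part of `G`; since `G` connects
  -- everything, only one label could occur.
  have hex : ∃ e ∈ cands, 1 < hits n (layered cands H 0) e.1 := by
    by_contra! hno
    have := numLabels_le_of_coarser (H := G.map fun e => e.1) (n := n) (fun T hT => by
      obtain ⟨e, he, rfl⟩ := List.mem_map.1 hT
      exact hc e (hG he)) (label n (layered cands H 0)) (fun T hT => by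
      obtain ⟨e, he, rfl⟩ := List.mem_map.1 hT
      simpa using card_image_le_one_iff.1 (hno e (hG he)))
    rw [← numLabels_eq] at this
    omega
  obtain ⟨e, he, hmin⟩ := Finset.exists_min_image
    (cands.toFinset.filter fun e => 1 < hits n (layered cands H 0) e.1) (fun e => e.2.length) (by
      obtain ⟨e, he, h⟩ := hex
      exact ⟨e, by simp [he, h]⟩)
  simp only [Finset.mem_filter, List.mem_toFinset, and_imp] at he hmin
  obtain ⟨he, hhit⟩ := he
  have hcost : 0 < e.2.length := by
    by_contra! h
    have := (card_image_le_one_iff (s := e.1.toFinset) (f := label n (layered cands H 0))).2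
      (by
        intro i hi j hj
        exact label_eq_of_mem (hl 0) (List.mem_append_right _ (mem_layer.2 ⟨e, he, h, rfl⟩))
          (by simpa using hi) (by simpa using hj))
    rw [hits] at hhit
    omega
  have hgain : ∀ t < e.2.length,
      1 ≤ numLabels n (layered cands H t) - numLabels n (e.1 :: layered cands H t) := by
    intro t ht
    have h1 := numLabels_cons (hl t) (hc e he)
    have h2 : hits n (layered cands H 0) e.1 ≤ hits n (layered cands H t) e.1 := by
      refine card_image_le_of_forall _ _ _ fun i hi j hj hij => ?_
      refine eq_of_label_eq (hl t) _ (fun T hT => ?_) (hc e he i (by simpa using hi))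
        (hc e he j (by simpa using hj)) hij
      rcases List.mem_append.1 hT with hT | hT
      · exact fun i hi j hj => label_eq_of_mem (hl 0) (List.mem_append_left _ hT) hi hj
      · obtain ⟨e', he', hle, rfl⟩ := mem_layer.1 hT
        have : hits n (layered cands H 0) e'.1 ≤ 1 := by
          by_contra! h
          have := hmin e' he' h
          omega
        simpa using card_image_le_one_iff.1 this
    omega
  have hle : e.2.length ≤ gain n cands H e := by
    rw [(gain_eq hc hH he).2]
    have hsplit : height cands = e.2.length + (height cands - e.2.length) := by
      have := cost_lt_height he
      omega
    rw [hsplit, List.range_add, List.map_append, List.sum_append]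
    refine le_add_right ?_
    calc e.2.length = ((List.range e.2.length).map fun _ => 1).sum := by simp
      _ ≤ _ := List.sum_le_sum fun t ht => hgain t (List.mem_range.1 ht)
  exact ⟨e, he, by omega, hle⟩

/-- Averaging: if every ratio `c e / g e` with `g e > 0` exceeded `(∑ c) / X`, summation would
contradict `X ≤ ∑ g`. -/
theorem exists_ratio_le {β : Type*} (G : List β) (c g : β → ℕ) (X : ℕ) (hX : 0 < X)
    (h : X ≤ (G.map g).sum) : ∃ e ∈ G, 0 < g e ∧ c e * X ≤ (G.map c).sum * g e := by
  by_contra! hno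
  have h1 : ((G.map fun e => (G.map c).sum * g e)).sum < (G.map fun e => c e * X).sum := by
    refine List.sum_lt_sum _ _ (fun e he => ?_) ?_
    · rcases Nat.eq_zero_or_pos (g e) with h0 | h0
      · simp [h0]
      · exact (hno e he h0).le
    · have : ∃ e ∈ G, 0 < g e := by
        by_contra! h0
        have : (G.map g).sum = 0 := List.sum_eq_zero_iff.2 (by
          intro x hx
          obtain ⟨e, he, rfl⟩ := List.mem_map.1 hx
          exact Nat.le_zero.1 (h0 e he))
        omega
      obtain ⟨e, he, h0⟩ := this
      exact ⟨e, he, hno e he h0⟩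
  rw [List.sum_map_mul_left, List.sum_map_mul_right] at h1
  exact absurd (Nat.mul_le_mul_left _ h) (not_le.2 h1)

/-- The total cost of a list of candidates. -/
def totalCost (H : List (Cand α)) : ℕ := (H.map fun e => e.2.length).sum

theorem best_spec (hc : ∀ e ∈ cands, ∀ i ∈ e.1, i < n) {H G : List (Cand α)}
    (hH : H ⊆ cands) (hG : G ⊆ cands) (hG1 : numLabels n (G.map fun e => e.1) ≤ 1)
    {e : Cand α} (hpos : 0 < excess n cands H) (he : e ∈ best n cands H) :
    e ∈ cands ∧ 0 < gain n cands H e ∧ e.2.length ≤ gain n cands H e ∧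
      e.2.length * excess n cands H ≤ totalCost G * gain n cands H e := by
  simp only [best, List.mem_filter, Bool.and_eq_true, Bool.not_eq_true', decide_eq_false_iff_not,
    List.all_eq_true, decide_eq_true_eq] at he
  obtain ⟨hec, hg, hall⟩ := he
  refine ⟨hec, Nat.pos_of_ne_zero hg, ?_, ?_⟩
  · obtain ⟨e', he', h1, h2⟩ := exists_cost_le_gain hc hH hG hG1 hpos
    have h3 := hall e' he'
    have h4 : e'.2.length * gain n cands H e ≤ gain n cands H e' * gain n cands H e :=
      Nat.mul_le_mul_right _ h2
    exact le_of_mul_le_mul_left (by linarith) h1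
  · obtain ⟨e', he', h1, h2⟩ := exists_ratio_le G (fun e => e.2.length)
      (fun e => gain n cands H e) _ hpos (excess_le_sum_gain hc hH hG hG1)
    have h3 := hall e' (hG he')
    refine le_of_mul_le_mul_left (a := gain n cands H e') ?_ h1
    calc gain n cands H e' * (e.2.length * excess n cands H)
        = (e.2.length * gain n cands H e') * excess n cands H := by ring
      _ ≤ (e'.2.length * gain n cands H e) * excess n cands H := Nat.mul_le_mul_right _ h3
      _ = (e'.2.length * excess n cands H) * gain n cands H e := by ring
      _ ≤ (totalCost G * gain n cands H e') * gain n cands H e :=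
        Nat.mul_le_mul_right _ h2
      _ = _ := by ring

theorem best_ne_nil (hc : ∀ e ∈ cands, ∀ i ∈ e.1, i < n) {H G : List (Cand α)}
    (hH : H ⊆ cands) (hG : G ⊆ cands) (hG1 : numLabels n (G.map fun e => e.1) ≤ 1)
    (hpos : 0 < excess n cands H) : best n cands H ≠ [] := by
  classical
  obtain ⟨e₀, he₀, h₀, -⟩ := exists_cost_le_gain hc hH hG hG1 hpos
  obtain ⟨e, he, hmin⟩ := Finset.exists_min_image
    (cands.toFinset.filter fun e => 0 < gain n cands H e)
    (fun e => (e.2.length : ℚ) / gain n cands H e) ⟨e₀, by simp [he₀, h₀]⟩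
  simp only [Finset.mem_filter, List.mem_toFinset, and_imp] at he hmin
  refine List.ne_nil_of_mem (a := e) ?_
  simp only [best, List.mem_filter, Bool.and_eq_true, Bool.not_eq_true', decide_eq_false_iff_not,
    List.all_eq_true, decide_eq_true_eq]
  refine ⟨he.1, he.2.ne', fun e' he' => ?_⟩
  rcases Nat.eq_zero_or_pos (gain n cands H e') with h0 | h0
  · simp [h0]
  · have := hmin e' he' h0
    rw [div_le_div_iff₀ (by exact_mod_cast he.2) (by exact_mod_cast h0)] at this
    exact_mod_cast this

/-- The bound for the total cost of the greedy algorithm, if the excess is `m` and some solution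
has cost `o`. -/
noncomputable def greedyBound (o m : ℝ) : ℝ := if m ≤ o then m else o * (1 + Real.log (m / o))

/-- For `o > 0` and `m ≥ 0`, `greedyBound o m` is the integral of `min 1 (o / x)` over `0 ≤ x ≤ m`.
The integrand is decreasing and `c ≤ (m - m') * min 1 (o / m)`, so `c` is at most the integral from
`m'` to `m`. The cases below replace the integral by `1 - 1 / x ≤ log x`; for `o = 0` the bound
vanishes. -/
theorem add_greedyBound_le {o m m' c : ℝ} (ho : 0 ≤ o) (hm' : 0 ≤ m') (hm : m' ≤ m)
    (h1 : c ≤ m - m') (h2 : c * m ≤ o * (m - m')) : c + greedyBound o m' ≤ greedyBound o m := by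
  unfold greedyBound
  rcases ho.eq_or_lt with rfl | ho
  · rcases hm'.eq_or_lt with rfl | hm'
    · rw [if_pos le_rfl]
      split_ifs with h3
      · linarith
      · push Not at h3
        have : c ≤ 0 := by nlinarith
        linarith
    · rw [if_neg (by linarith), if_neg (by linarith)]
      have : c ≤ 0 := by nlinarith
      linarith
  split_ifs with h3 h4 h4
  · linarith
  · push Not at h4
    have hmp : 0 < m := by linarith
    have hlog : 1 - o / m ≤ Real.log (m / o) := by
      have := Real.one_sub_inv_le_log_of_pos (div_pos hmp ho)
      rwa [inv_div] at this
    have hc : c ≤ o * (m - m') / m := by rwa [le_div_iff₀ hmp]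
    have h5 : o * (1 + (1 - o / m)) ≤ o * (1 + Real.log (m / o)) := by gcongr
    have h6 : o * (m - m') / m + m' ≤ o * (1 + (1 - o / m)) := by
      have : o * (1 + (1 - o / m)) - (o * (m - m') / m + m') = (o - m') * (m - o) / m := by
        field_simp; ring
      have : 0 ≤ (o - m') * (m - o) / m :=
        div_nonneg (mul_nonneg (by linarith) (by linarith)) hmp.le
      linarith
    linarith
  · linarith
  · push Not at h3 h4
    have hmp : 0 < m := by linarith
    have hmp' : 0 < m' := by linarith
    have hlog : 1 - m' / m ≤ Real.log (m / m') := by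
      have := Real.one_sub_inv_le_log_of_pos (div_pos hmp hmp')
      rwa [inv_div] at this
    have hc : c ≤ o * (1 - m' / m) := by
      have : o * (1 - m' / m) = o * (m - m') / m := by field_simp
      rwa [this, le_div_iff₀ hmp]
    have h5 : Real.log (m / o) = Real.log (m / m') + Real.log (m' / o) := by
      rw [Real.log_div hmp.ne' ho.ne', Real.log_div hmp.ne' hmp'.ne',
        Real.log_div hmp'.ne' ho.ne']
      ring
    have h6 : o * (1 - m' / m) ≤ o * Real.log (m / m') := by gcongr
    rw [h5]
    linarith

/-- Each effective step lowers the natural number `excess` by at least one, so `excess n cands []`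
rounds suffice, and the step bounds telescope through `greedyBound`. The family `G` occurs only in
the analysis, so the same run can be compared with every connecting family. -/
theorem greedy_spec (hc : ∀ e ∈ cands, ∀ i ∈ e.1, i < n) {G : List (Cand α)}
    (hG : G ⊆ cands) (hG1 : numLabels n (G.map fun e => e.1) ≤ 1) :
    greedy n cands ⊆ cands ∧ excess n cands (greedy n cands) = 0 ∧
      (totalCost (greedy n cands) : ℝ) ≤
        greedyBound (totalCost G) (excess n cands []) := by
  have key : ∀ (m : ℕ) (H : List (Cand α)), H ⊆ cands → excess n cands H ≤ m →
      ∀ H', H' = (List.replicate m ()).foldl (fun H _ => greedyStep n cands H) H →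
      H' ⊆ cands ∧ excess n cands H' = 0 ∧ (totalCost H' : ℝ) ≤
        totalCost H +
          greedyBound (totalCost G) (excess n cands H) := by
    intro m
    induction m with
    | zero =>
      rintro H hH hm H' hH'
      obtain rfl : H' = H := hH'
      have h0 : excess n cands H' = 0 := by omega
      refine ⟨hH, h0, ?_⟩
      simp [h0, greedyBound]
    | succ m ih =>
      rintro H hH hm H' rfl
      rw [List.replicate_succ, List.foldl_cons]
      rcases Nat.eq_zero_or_pos (excess n cands H) with h0 | hpos
      · have hb : best n cands H = [] := by
          refine List.filter_eq_nil_iff.2 fun e _ => ?_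
          have : gain n cands H e = 0 := by rw [gain, h0]; simp
          simp [this]
        have : greedyStep n cands H = H := by simp [greedyStep, hb]
        rw [this]
        exact ih H hH (by omega) _ rfl
      · cases hb : best n cands H with
        | nil => exact absurd hb (best_ne_nil hc hH hG hG1 hpos)
        | cons e l =>
          obtain ⟨he, hg, h1, h2⟩ := best_spec hc hH hG hG1 hpos
            (hb ▸ List.mem_cons_self : e ∈ best n cands H)
          have hstep : greedyStep n cands H = e :: H := by simp [greedyStep, hb]
          have hex := (gain_eq hc hH he).1
          rw [hstep]
          obtain ⟨h3, h4, h5⟩ := ih (e :: H) (List.cons_subset.2 ⟨he, hH⟩) (by omega) _ rfl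
          refine ⟨h3, h4, h5.trans ?_⟩
          have hex' : (gain n cands H e : ℝ) =
              excess n cands H - excess n cands (e :: H) := by
            rw [← hex]; push_cast; ring
          have := add_greedyBound_le (o := (totalCost G : ℕ))
            (m := excess n cands H) (m' := excess n cands (e :: H)) (c := (e.2.length : ℕ))
            (by positivity) (by positivity) (by exact_mod_cast (by omega))
            (by rw [← hex']; exact_mod_cast h1) (by rw [← hex']; exact_mod_cast h2)
          have hcost : (totalCost (e :: H) : ℝ) = e.2.length + totalCost H := by
            simp [totalCost]
          linarith
  obtain ⟨h1, h2, h3⟩ := key _ [] (List.nil_subset _) le_rfl (greedy n cands) rfl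
  exact ⟨h1, h2, by simpa [totalCost] using h3⟩

theorem greedyBound_le {o m D : ℝ} (ho : 0 ≤ o) (hD : 1 ≤ D) (hm : m ≤ D * o) :
    greedyBound o m ≤ (1 + Real.log D) * o := by
  have hlog := Real.log_nonneg hD
  unfold greedyBound
  split_ifs with h
  · nlinarith
  · push Not at h
    rcases ho.eq_or_lt with rfl | ho
    · simp
    · rw [mul_comm]
      have : Real.log (m / o) ≤ Real.log D :=
        Real.log_le_log (div_pos (by linarith) ho) ((div_le_iff₀ ho).2 hm)
      gcongr

theorem label_eq_of_excess_eq_zero {H : List (Cand α)} (h : excess n cands H = 0)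
    {i j : ℕ} (hi : i < n) (hj : j < n) :
    label n (layered cands H 0) i = label n (layered cands H 0) j := by
  have h1 : ¬ 1 < numLabels n (layered cands H 0) := fun h' =>
    h.not_gt (excess_pos_iff.2 ⟨0, Nat.succ_pos _, h'⟩)
  rw [numLabels_eq, not_lt, card_image_le_one_iff] at h1
  exact h1 i (Finset.mem_range.2 hi) j (Finset.mem_range.2 hj)

end

section Linked

open scoped Classical

/-! ### Components of threshold graphs -/

section Metric

variable {M : Type*} [MetricSpace M]

/-- The points `x` and `y` are joined by a chain of points of `Y` with steps of length at most
`r`. -/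
def Linked (r : ℝ) (Y : Set M) : M → M → Prop :=
  Relation.ReflTransGen fun a b => a ∈ Y ∧ b ∈ Y ∧ dist a b ≤ r

theorem Linked.symm {r : ℝ} {Y : Set M} {x y : M} (h : Linked r Y x y) : Linked r Y y x := by
  induction h with
  | refl => exact .refl
  | tail _ h ih => exact .head ⟨h.2.1, h.1, by rw [dist_comm]; exact h.2.2⟩ ih

theorem Linked.mono {r r' : ℝ} {Y Y' : Set M} {x y : M} (h : Linked r Y x y) (hr : r ≤ r')
    (hY : Y ⊆ Y') : Linked r' Y' x y :=
  Relation.ReflTransGen.mono (fun _ _ h => ⟨hY h.1, hY h.2.1, h.2.2.trans hr⟩) _ _ h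

theorem Linked.of_dist_le {r : ℝ} {Y : Set M} {x y : M} (hx : x ∈ Y) (hy : y ∈ Y)
    (h : dist x y ≤ r) : Linked r Y x y := Relation.ReflTransGen.single ⟨hx, hy, h⟩

theorem Linked.apply_eq {B : Type*} {r : ℝ} {Y : Set M} {x y : M} (h : Linked r Y x y)
    (φ : M → B) (hφ : ∀ a ∈ Y, ∀ b ∈ Y, dist a b ≤ r → φ a = φ b) : φ x = φ y := by
  induction h with
  | refl => rfl
  | tail _ h ih => exact ih.trans (hφ _ h.1 _ h.2.1 h.2.2)

/-- A chain from a point of `Z` stays in `Z` if `Z` is closed under short steps. -/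
theorem Linked.restrict {r : ℝ} {Y Z : Set M} {x y : M} (h : Linked r Y x y) (hx : x ∈ Z)
    (hZ : ∀ a ∈ Z, ∀ b ∈ Y, dist a b ≤ r → b ∈ Z) : y ∈ Z ∧ Linked r Z x y := by
  induction h with
  | refl => exact ⟨hx, .refl⟩
  | tail _ h ih =>
    have := hZ _ ih.1 _ h.2.1 h.2.2
    exact ⟨this, ih.2.tail ⟨ih.1, this, h.2.2⟩⟩

/-- The component of `x`. -/
def component (r : ℝ) (Y : Set M) (x : M) : Set M := {y | Linked r Y x y}

theorem component_eq_iff {r : ℝ} {Y : Set M} {x y : M} :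
    component r Y x = component r Y y ↔ Linked r Y x y := by
  constructor
  · intro h
    have : y ∈ component r Y y := Relation.ReflTransGen.refl
    rwa [← h] at this
  · intro h
    ext z
    exact ⟨fun hz => h.symm.trans hz, fun hz => h.trans hz⟩

/-- The number of components of the graph on `X` whose edges are the pairs at distance at most
`r`. -/
noncomputable def numComponents (r : ℝ) (X : Finset M) : ℕ :=
  (X.image (component r (X : Set M))).card

theorem card_image_le_numComponents {B : Type*} [DecidableEq B] {r : ℝ} {X : Finset M} (φ : M → B)
    (hφ : ∀ a ∈ X, ∀ b ∈ X, dist a b ≤ r → φ a = φ b) : (X.image φ).card ≤ numComponents r X :=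
  card_image_le_of_forall _ _ _ fun _ _ _ _ h => (component_eq_iff.1 h).apply_eq φ hφ

theorem numComponents_le_one {r : ℝ} {X : Finset M} (x : M)
    (h : ∀ y ∈ X, Linked r (X : Set M) x y) : numComponents r X ≤ 1 := by
  rw [numComponents, card_image_le_one_iff]
  exact fun i hi j hj => component_eq_iff.2 ((h i hi).symm.trans (h j hj))

theorem one_le_numComponents {r : ℝ} {X : Finset M} (hX : X.Nonempty) : 1 ≤ numComponents r X :=
  Finset.card_pos.2 (hX.image _)

/-- The components of `X`, other than that of `p`, which have a point near `v`. -/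
noncomputable def nearComponents (r : ℝ) (X : Finset M) (p v : M) : Finset (Set M) :=
  (X.image (component r (X : Set M))).filter fun C =>
    C ≠ component r (X : Set M) p ∧ ∃ u ∈ X, component r (X : Set M) u = C ∧ dist v u ≤ r

/-- Inserting `v` merges at most the components near `v` with that of `p`. The map `φ` performs this
merger and is constant along edges of the enlarged graph, so it bounds the number of components from
below. -/
theorem numComponents_le_insert {r : ℝ} {X : Finset M} {p v : M} (hv : v ∉ X) (hvp : dist v p ≤ r) :
    numComponents r X ≤ numComponents r (insert v X) + (nearComponents r X p v).card := by
  set cl := component r (X : Set M) with hcl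
  set N := nearComponents r X p v with hN
  let φ : M → Set M := fun x => if x = v ∨ cl x ∈ N then cl p else cl x
  have hnear : ∀ b ∈ X, dist v b ≤ r → φ b = cl p := by
    intro b hb h
    by_cases hbp : cl b = cl p
    · simp only [φ]
      split_ifs
      exacts [rfl, hbp]
    · have : cl b ∈ N := by
        rw [hN, nearComponents, Finset.mem_filter]
        exact ⟨Finset.mem_image_of_mem _ hb, hbp, b, hb, rfl, h⟩
      simp [φ, this]
  have hφv : φ v = cl p := by simp [φ]
  have h1 : ((insert v X).image φ).card ≤ numComponents r (insert v X) := by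
    refine card_image_le_numComponents φ fun a ha b hb hab => ?_
    rcases Finset.mem_insert.1 ha with rfl | ha' <;>
      rcases Finset.mem_insert.1 hb with rfl | hb'
    · rfl
    · rw [hφv, hnear b hb' hab]
    · rw [hφv, hnear a ha' (by rwa [dist_comm])]
    · have : cl a = cl b := component_eq_iff.2 (Linked.of_dist_le ha' hb' hab)
      have ha' : a ≠ v := by rintro rfl; exact hv ha'
      have hb' : b ≠ v := by rintro rfl; exact hv hb'
      simp only [φ, this, ha', hb', false_or]
  have h2 : (X.image cl) \ N ⊆ (insert v X).image φ := by
    intro C hC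
    rw [Finset.mem_sdiff] at hC
    obtain ⟨x, hx, rfl⟩ := Finset.mem_image.1 hC.1
    refine Finset.mem_image.2 ⟨x, Finset.mem_insert_of_mem hx, ?_⟩
    have hx' : x ≠ v := by rintro rfl; exact hv hx
    simp only [φ, hx', hC.2, or_self, if_false]
  have h3 := Finset.card_le_card h2
  have h4 := Finset.le_card_sdiff N (X.image cl)
  have h5 : numComponents r X = (X.image cl).card := rfl
  omega

end Metric

/-! ### Packing in normed spaces and the spanning tree bound -/

section Normed

theorem IsIndependenceNumber.card_le {E : Type*} [NormedAddCommGroup E] {Δ : ℕ}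
    (hΔ : IsIndependenceNumber E Δ) {β : Type*} (J : Finset β) (g : β → E) (v : E) (h1 : ∀ i ∈ J, dist (g i) v ≤ 1)
    (h2 : ∀ i ∈ J, ∀ j ∈ J, i ≠ j → 1 < dist (g i) (g j)) : J.card ≤ Δ := by
  refine hΔ.2 ⟨J.image fun i => g i - v, ?_, ?_, ?_⟩
  · intro x hx
    obtain ⟨i, hi, rfl⟩ := Finset.mem_image.1 (Finset.mem_coe.1 hx)
    have := h1 i hi
    rw [mem_closedBall_zero_iff, ← dist_eq_norm]
    exact this
  · intro x hx y hy hxy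
    obtain ⟨i, hi, rfl⟩ := Finset.mem_image.1 (Finset.mem_coe.1 hx)
    obtain ⟨j, hj, rfl⟩ := Finset.mem_image.1 (Finset.mem_coe.1 hy)
    have := h2 i hi j hj (by rintro rfl; exact hxy rfl)
    simpa using this
  · refine Finset.card_image_of_injOn fun i hi j hj hij => ?_
    by_contra hne
    have := h2 i hi j hj hne
    rw [sub_left_injective hij, dist_self] at this
    linarith

theorem IsIndependenceNumber.one_le {E : Type*} [NormedAddCommGroup E] {Δ : ℕ}
    (hΔ : IsIndependenceNumber E Δ) : 1 ≤ Δ := by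
  have := hΔ.card_le {()} (fun _ => 0) 0 (by simp) (by simp)
  simpa using this

variable {E : Type*} [NormedAddCommGroup E] [NormedSpace ℝ E] {Δ : ℕ}

/-- For `‖a‖ ≤ ‖b‖`, shrinking `b` to length `‖a‖` moves it by `‖b‖ - ‖a‖`. Its distance from `a` is
then at least `‖a - b‖ - ‖b‖ + ‖a‖ > ‖a‖`; scaling by `‖a‖⁻¹` finishes. -/
theorem one_lt_dist_normalized {a b : E} (ha : a ≠ 0) (hb : b ≠ 0) (h1 : ‖a‖ < ‖a - b‖)
    (h2 : ‖b‖ < ‖a - b‖) : 1 < ‖‖a‖⁻¹ • a - ‖b‖⁻¹ • b‖ := by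
  wlog hab : ‖a‖ ≤ ‖b‖ generalizing a b
  · rw [norm_sub_rev]
    exact this hb ha (by rwa [norm_sub_rev]) (by rwa [norm_sub_rev]) (le_of_not_ge hab)
  have ha' : 0 < ‖a‖ := norm_pos_iff.2 ha
  have hb' : 0 < ‖b‖ := norm_pos_iff.2 hb
  have e1 : ‖a‖⁻¹ • a - ‖b‖⁻¹ • b = ‖a‖⁻¹ • (a - (‖a‖ * ‖b‖⁻¹) • b) := by
    rw [smul_sub, smul_smul, ← mul_assoc, inv_mul_cancel₀ ha'.ne', one_mul]
  have e2 : ‖b - (‖a‖ * ‖b‖⁻¹) • b‖ = ‖b‖ - ‖a‖ := by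
    have h0 : b - (‖a‖ * ‖b‖⁻¹) • b = (1 - ‖a‖ * ‖b‖⁻¹) • b := by rw [sub_smul, one_smul]
    have h3 : ‖a‖ * ‖b‖⁻¹ ≤ 1 := by
      rw [← div_eq_mul_inv]; exact (div_le_one hb').2 hab
    rw [h0, norm_smul, Real.norm_of_nonneg (by linarith)]
    field_simp
  have e3 : ‖a - b‖ ≤ ‖a - (‖a‖ * ‖b‖⁻¹) • b‖ + ‖b - (‖a‖ * ‖b‖⁻¹) • b‖ := by
    have : a - b = (a - (‖a‖ * ‖b‖⁻¹) • b) - (b - (‖a‖ * ‖b‖⁻¹) • b) := by abel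
    rw [this]; exact norm_sub_le _ _
  rw [e1, norm_smul, norm_inv, norm_norm, ← div_eq_inv_mul, one_lt_div ha']
  linarith

theorem IsIndependenceNumber.two_le [Nontrivial E] (hΔ : IsIndependenceNumber E Δ) : 2 ≤ Δ := by
  obtain ⟨x, hx⟩ := exists_norm_eq E zero_le_one
  have hd : dist x (-x) = 2 := by
    rw [dist_eq_norm, sub_neg_eq_add, ← two_smul ℝ x, norm_smul, hx]; simp
  have := hΔ.card_le (Finset.univ : Finset Bool) (fun b => if b then x else -x) 0
    (by intro b _; cases b <;> simp [hx])
    (by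
      intro a _ b _ hab
      cases a <;> cases b <;> simp_all [dist_comm (-x) x])
  simpa using this

/-- Radial projection from `v` to the unit sphere turns the points into ones at pairwise distance
larger than one. With at least two points, none of them can coincide with `v`. -/
theorem IsIndependenceNumber.card_le_of_separated (hΔ : IsIndependenceNumber E Δ) {β : Type*}
    (J : Finset β) (g : β → E) (v : E)
    (h : ∀ i ∈ J, ∀ j ∈ J, i ≠ j → dist (g i) v < dist (g i) (g j)) : J.card ≤ Δ := by
  rcases Nat.lt_or_ge 1 J.card with hJ | hJ
  · have hne : ∀ i ∈ J, g i - v ≠ 0 := by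
      intro i hi h0
      obtain ⟨j, hj, hji⟩ := Finset.exists_mem_ne hJ i
      have := h j hj i hi hji
      rw [sub_eq_zero.1 h0] at this
      exact lt_irrefl _ this
    refine hΔ.card_le J (fun i => ‖g i - v‖⁻¹ • (g i - v)) 0 (fun i hi => ?_)
      fun i hi j hj hij => ?_
    · rw [dist_zero_right, norm_smul, norm_inv, norm_norm,
        inv_mul_cancel₀ (norm_ne_zero_iff.2 (hne i hi))]
    · rw [dist_eq_norm]
      have h1 := h i hi j hj hij
      have h2 := h j hj i hi hij.symm
      rw [dist_comm (g j) (g i)] at h2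
      simp only [dist_eq_norm] at h1 h2
      have e : g i - v - (g j - v) = g i - g j := by abel
      exact one_lt_dist_normalized (hne i hi) (hne j hj) (by rwa [e]) (by rwa [e])
  · exact hJ.trans hΔ.one_le

/-- One packing handles all thresholds at once. For each near component, at threshold `t + 1`,
choose a point `u` of it within `t + 1` of `v`; together with `p` these points satisfy
`card_le_of_separated`. For `t < t'` the earlier point is within `t + 2 ≤ t' + 1` of `p`, hence in
the component of `p` at threshold `t' + 1`, so the later point is farther than `t' + 1` from it. The
`+ 1` in the statement counts `p`. -/
theorem sum_card_nearComponents (hΔ : IsIndependenceNumber E Δ) {X : Finset E} {p v : E}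
    (hp : p ∈ X) (hvp : dist v p ≤ 1) (L : ℕ) :
    ∑ t ∈ Finset.range L, (nearComponents ((t : ℝ) + 1) X p v).card + 1 ≤ Δ := by
  have hex : ∀ (t : ℕ) (C : Set E), C ∈ nearComponents ((t : ℝ) + 1) X p v →
      ∃ u ∈ X, component ((t : ℝ) + 1) (X : Set E) u = C ∧ dist v u ≤ (t : ℝ) + 1 :=
    fun t C hC => (Finset.mem_filter.1 hC).2.2
  have hne : ∀ (t : ℕ) (C : Set E), C ∈ nearComponents ((t : ℝ) + 1) X p v →
      C ≠ component ((t : ℝ) + 1) (X : Set E) p :=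
    fun t C hC => (Finset.mem_filter.1 hC).2.1
  choose! u hu1 hu2 hu3 using hex
  have hpu : ∀ (t : ℕ) (C : Set E), C ∈ nearComponents ((t : ℝ) + 1) X p v →
      (t : ℝ) + 1 < dist p (u t C) := by
    intro t C hC
    by_contra! h
    exact hne t C hC ((hu2 t C hC).symm.trans
      (component_eq_iff.2 (Linked.of_dist_le hp (hu1 t C hC) h)).symm)
  have huu : ∀ (t t' : ℕ) (C C' : Set E), C ∈ nearComponents ((t : ℝ) + 1) X p v →
      C' ∈ nearComponents ((t' : ℝ) + 1) X p v → t < t' →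
      (t' : ℝ) + 1 < dist (u t C) (u t' C') := by
    intro t t' C C' hC hC' htt
    by_contra! h
    have h1 : dist p (u t C) ≤ (t' : ℝ) + 1 := by
      have h2 := dist_triangle_left p (u t C) v
      have h3 := hu3 t C hC
      have h4 : (t : ℝ) + 1 ≤ t' := by exact_mod_cast htt
      linarith
    have h5 := (Linked.of_dist_le hp (hu1 t C hC) h1).trans
      (Linked.of_dist_le (Y := (X : Set E)) (hu1 t C hC) (hu1 t' C' hC') h)
    exact hne t' C' hC' ((hu2 t' C' hC').symm.trans (component_eq_iff.2 h5).symm)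
  have huu' : ∀ (t : ℕ) (C C' : Set E), C ∈ nearComponents ((t : ℝ) + 1) X p v →
      C' ∈ nearComponents ((t : ℝ) + 1) X p v → C ≠ C' →
      (t : ℝ) + 1 < dist (u t C) (u t C') := by
    intro t C C' hC hC' hCC
    by_contra! h
    exact hCC ((hu2 t C hC).symm.trans ((component_eq_iff.2
      (Linked.of_dist_le (hu1 t C hC) (hu1 t C' hC') h)).trans (hu2 t C' hC')))
  set J : Finset (Σ _ : ℕ, Set E) :=
    (Finset.range L).sigma fun t => nearComponents ((t : ℝ) + 1) X p v with hJ
  have hcard : J.card = ∑ t ∈ Finset.range L, (nearComponents ((t : ℝ) + 1) X p v).card := by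
    rw [hJ, Finset.card_sigma]
  rw [← hcard, ← Finset.card_insertNone]
  refine hΔ.card_le_of_separated (Finset.insertNone J)
    (fun o => o.elim p fun s => u s.1 s.2) v ?_
  have hmem : ∀ s, some s ∈ Finset.insertNone J →
      s.2 ∈ nearComponents ((s.1 : ℝ) + 1) X p v := fun s hs => by
    rw [Finset.some_mem_insertNone, hJ, Finset.mem_sigma] at hs
    exact hs.2
  rintro (_ | ⟨t, C⟩) hi (_ | ⟨t', C'⟩) hj hij
  · exact absurd rfl hij
  · have h1 := hpu _ _ (hmem _ hj)
    simp only [Option.elim_none, Option.elim_some]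
    rw [dist_comm p v]
    have : (0 : ℝ) ≤ t' := Nat.cast_nonneg _
    simp only at h1
    linarith
  · have h1 := hpu _ _ (hmem _ hi)
    have h2 := hu3 _ _ (hmem _ hi)
    simp only [Option.elim_none, Option.elim_some] at h1 h2 ⊢
    rw [dist_comm _ v, dist_comm _ p]
    linarith
  · have hC := hmem _ hi
    have hC' := hmem _ hj
    have h2 := hu3 _ _ hC
    simp only [Option.elim_some] at hC hC' h2 ⊢
    rw [dist_comm _ v]
    rcases lt_trichotomy t t' with h | rfl | h
    · have h3 := huu _ _ _ _ hC hC' h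
      have : (t : ℝ) ≤ t' := by exact_mod_cast h.le
      linarith
    · have := huu' _ _ _ hC hC' (by rintro rfl; exact hij rfl)
      linarith
    · have := huu _ _ _ _ hC' hC h
      rw [dist_comm (u t C)]
      linarith

theorem sum_numComponents_le_insert (hΔ : IsIndependenceNumber E Δ) {X : Finset E} {p v : E}
    (hp : p ∈ X) (hv : v ∉ X) (hvp : dist v p ≤ 1) (L : ℕ) :
    ∑ t ∈ Finset.range L, numComponents ((t : ℝ) + 1) X + 1 ≤
      ∑ t ∈ Finset.range L, numComponents ((t : ℝ) + 1) (insert v X) + Δ := by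
  have h1 := sum_card_nearComponents hΔ hp hvp L
  have h2 : ∑ t ∈ Finset.range L, numComponents ((t : ℝ) + 1) X ≤ ∑ t ∈ Finset.range L,
      (numComponents ((t : ℝ) + 1) (insert v X) + (nearComponents ((t : ℝ) + 1) X p v).card) :=
    Finset.sum_le_sum fun t _ => numComponents_le_insert hv
      (hvp.trans (by have : (0 : ℝ) ≤ t := Nat.cast_nonneg _
                     linarith))
  rw [Finset.sum_add_distrib] at h2
  omega

/-- A minimum spanning tree has at most `Δ - 1` times as many Steiner points as any solution. -/
theorem sum_numComponents_sub_one_le (hΔ : IsIndependenceNumber E Δ) {R S : Finset E}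
    (h : ∀ x ∈ R, ∀ y ∈ R, Linked 1 (↑(R ∪ S) : Set E) x y) (L : ℕ) :
    ∑ t ∈ Finset.range L, (numComponents ((t : ℝ) + 1) R - 1) ≤ (Δ - 1) * S.card := by
  rcases R.eq_empty_or_nonempty with rfl | ⟨r₀, hr₀⟩
  · simp [numComponents]
  -- `Q A` records that `A` is reachable from the terminals and that its points lowered the sum by
  -- at most `Δ - 1` each, written without subtraction. A largest such `A` is closed under unit
  -- steps, so `R ∪ A` is connected.
  let Q : Finset E → Prop := fun A =>
    (∀ a ∈ A, Linked 1 (↑(R ∪ S) : Set E) r₀ a) ∧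
    ∑ t ∈ Finset.range L, numComponents ((t : ℝ) + 1) R + A.card ≤
      ∑ t ∈ Finset.range L, numComponents ((t : ℝ) + 1) (R ∪ A) + Δ * A.card
  obtain ⟨A, hA, hmax⟩ := Finset.exists_max_image (S.powerset.filter Q) Finset.card
    ⟨∅, by simp [Q]⟩
  simp only [Finset.mem_filter, Finset.mem_powerset, and_imp] at hA hmax
  obtain ⟨hAS, hA1, hA2⟩ := hA
  have hRA : ∀ x ∈ R ∪ A, Linked 1 (↑(R ∪ S) : Set E) r₀ x := by
    intro x hx
    rcases Finset.mem_union.1 hx with hx | hx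
    exacts [h _ hr₀ _ hx, hA1 x hx]
  have hclosed : ∀ x ∈ R ∪ A, ∀ y ∈ R ∪ S, dist x y ≤ 1 → y ∈ R ∪ A := by
    intro x hx y hy hxy
    by_contra hyn
    have hyS : y ∈ S := by
      rcases Finset.mem_union.1 hy with hy | hy
      exacts [absurd (Finset.mem_union_left _ hy) hyn, hy]
    have hyA : y ∉ A := fun h => hyn (Finset.mem_union_right _ h)
    have h1 := hmax (insert y A) (Finset.insert_subset hyS hAS) ⟨?_, ?_⟩
    · rw [Finset.card_insert_of_notMem hyA] at h1
      omega
    · intro a ha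
      rcases Finset.mem_insert.1 ha with rfl | ha
      · exact (hRA x hx).tail ⟨Finset.union_subset_union_right hAS hx, hy, hxy⟩
      · exact hA1 a ha
    · have h2 := sum_numComponents_le_insert hΔ hx hyn (by rwa [dist_comm]) L
      rw [Finset.card_insert_of_notMem hyA, Finset.union_insert, mul_add, mul_one]
      omega
  have hone : ∀ t ∈ Finset.range L, numComponents ((t : ℝ) + 1) (R ∪ A) ≤ 1 := by
    intro t _
    refine numComponents_le_one r₀ fun y hy => ?_
    refine Linked.mono (Linked.restrict (Z := (↑(R ∪ A) : Set E)) (hRA y hy)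
      (Finset.mem_union_left _ hr₀) hclosed).2 ?_ subset_rfl
    have : (0 : ℝ) ≤ t := Nat.cast_nonneg _
    linarith
  have h1 := Finset.sum_le_sum hone
  have h2 : ∑ t ∈ Finset.range L, (numComponents ((t : ℝ) + 1) R - 1) +
      ∑ t ∈ Finset.range L, 1 = ∑ t ∈ Finset.range L, numComponents ((t : ℝ) + 1) R := by
    rw [← Finset.sum_add_distrib]
    exact Finset.sum_congr rfl fun t _ => Nat.sub_add_cancel (one_le_numComponents ⟨r₀, hr₀⟩)
  have h3 := Finset.card_le_card hAS
  obtain ⟨d, rfl⟩ : ∃ d, Δ = d + 1 := ⟨Δ - 1, by have := hΔ.one_le; omega⟩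
  have h4 : d * A.card ≤ d * S.card := Nat.mul_le_mul_left _ h3
  rw [add_mul, one_mul] at hA2
  rw [Nat.add_sub_cancel]
  omega

end Normed

end Linked

section Restricted

/-! ### Solutions composed of parts with few terminals -/

open scoped Classical

section Metric

variable {M : Type*} [MetricSpace M]

/-- The unit-disk graph of `Y` is connected. -/
def IsLinked (Y : Finset M) : Prop := ∀ x ∈ Y, ∀ y ∈ Y, Linked 1 (Y : Set M) x y

theorem IsLinked.of_center {Y : Finset M} (v : M) (h : ∀ y ∈ Y, Linked 1 (Y : Set M) v y) :
    IsLinked Y := fun x hx y hy => (h x hx).symm.trans (h y hy)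

theorem isLinked_singleton (v : M) : IsLinked {v} := by
  intro x hx y hy
  rw [Finset.mem_singleton.1 hx, Finset.mem_singleton.1 hy]
  exact .refl

theorem isLinked_insert_biUnion {β : Type*} (I : Finset β) (Y : β → Finset M) (c : β → M) (v : M)
    (hY : ∀ C ∈ I, IsLinked (Y C)) (hc : ∀ C ∈ I, c C ∈ Y C) (hd : ∀ C ∈ I, dist (c C) v ≤ 1) :
    IsLinked (insert v (I.biUnion Y)) := by
  refine IsLinked.of_center v fun y hy => ?_
  rcases Finset.mem_insert.1 hy with rfl | hy
  · exact .refl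
  · obtain ⟨C, hC, hyC⟩ := Finset.mem_biUnion.1 hy
    have hsub : (Y C : Set M) ⊆ ↑(insert v (I.biUnion Y)) := fun z hz =>
      Finset.mem_insert_of_mem (Finset.mem_biUnion.2 ⟨C, hC, hz⟩)
    refine .trans (b := c C) (Linked.of_dist_le (Finset.mem_insert_self _ _) (hsub (hc C hC)) ?_)
      ((hY C hC _ (hc C hC) _ hyC).mono le_rfl hsub)
    rw [dist_comm]; exact hd C hC

theorem IsLinked.insert {Y : Finset M} (hY : IsLinked Y) {c v : M} (hc : c ∈ Y)
    (hd : dist c v ≤ 1) : IsLinked (insert v Y) := by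
  have := isLinked_insert_biUnion {()} (fun _ => Y) (fun _ => c) v (by simpa) (by simpa) (by simpa)
  simpa using this

/-- The component of `x` in `Y`, as a finite set. -/
noncomputable def comp (Y : Finset M) (x : M) : Finset M := Y.filter (Linked 1 (Y : Set M) x)

theorem mem_comp {Y : Finset M} {x y : M} : y ∈ comp Y x ↔ y ∈ Y ∧ Linked 1 (Y : Set M) x y := by
  simp [comp]

theorem comp_closed {Y : Finset M} {x a b : M} (ha : a ∈ comp Y x) (hb : b ∈ Y)
    (h : dist a b ≤ 1) : b ∈ comp Y x := by
  rw [mem_comp] at ha ⊢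
  exact ⟨hb, ha.2.tail ⟨ha.1, hb, h⟩⟩

theorem comp_eq_of_mem {Y : Finset M} {x y : M} (h : y ∈ comp Y x) : comp Y y = comp Y x := by
  ext z
  rw [mem_comp] at h
  simp only [mem_comp]
  exact ⟨fun hz => ⟨hz.1, h.2.trans hz.2⟩, fun hz => ⟨hz.1, h.2.symm.trans hz.2⟩⟩

theorem isLinked_comp {Y : Finset M} {x : M} (hx : x ∈ Y) : IsLinked (comp Y x) := by
  refine IsLinked.of_center x fun y hy => ?_
  exact (Linked.restrict (mem_comp.1 hy).2 (Z := (comp Y x : Set M)) (mem_comp.2 ⟨hx, .refl⟩)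
    fun a ha b hb h => comp_closed ha hb h).2

/-- A chain from `x` to `v` in the connected set `X` must leave the component of `x` in `X.erase v`,
and it can only do so by a step to `v`. This point serves as the root of the branch. -/
theorem exists_mem_comp_erase {X : Finset M} (hX : IsLinked X) {v x : M} (hv : v ∈ X)
    (hx : x ∈ X.erase v) : ∃ c ∈ comp (X.erase v) x, dist c v ≤ 1 := by
  by_contra! hno
  have := (Linked.restrict (hX x (Finset.mem_of_mem_erase hx) v hv)
    (Z := (comp (X.erase v) x : Set M)) (mem_comp.2 ⟨hx, .refl⟩) fun a ha b hb h => by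
      refine comp_closed ha ?_ h
      refine Finset.mem_erase.2 ⟨?_, hb⟩
      rintro rfl
      exact (hno a ha).not_ge h).1
  exact absurd (mem_comp.1 this).1 (Finset.notMem_erase v X)

/-- The components of `X` without `v` which contain terminals. -/
noncomputable def branches (R X : Finset M) (v : M) : Finset (Finset M) :=
  ((X.erase v).image (comp (X.erase v))).filter fun C => (C ∩ R).Nonempty

theorem mem_branches {R X : Finset M} {v : M} {C : Finset M} : C ∈ branches R X v ↔
    (∃ x ∈ X.erase v, comp (X.erase v) x = C) ∧ (C ∩ R).Nonempty := by
  simp only [branches, Finset.mem_filter, Finset.mem_image]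

theorem eq_of_mem_branches {R X : Finset M} {v : M} {C C' : Finset M} (hC : C ∈ branches R X v)
    (hC' : C' ∈ branches R X v) {x y : M} (hx : x ∈ C) (hy : y ∈ C') (h : dist x y ≤ 1) :
    C = C' := by
  obtain ⟨⟨a, ha, rfl⟩, -⟩ := mem_branches.1 hC
  obtain ⟨⟨b, hb, rfl⟩, -⟩ := mem_branches.1 hC'
  rw [← comp_eq_of_mem hy]
  exact (comp_eq_of_mem (comp_closed hx (mem_comp.1 hy).1 h)).symm

theorem subset_of_mem_branches {R X : Finset M} {v : M} {C : Finset M}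
    (hC : C ∈ branches R X v) : C ⊆ X.erase v := by
  obtain ⟨⟨a, ha, rfl⟩, -⟩ := mem_branches.1 hC
  exact Finset.filter_subset _ _

theorem exists_branch {R X : Finset M} {v x : M} (hx : x ∈ X ∩ R) (hxv : x ≠ v) :
    ∃ C ∈ branches R X v, x ∈ C := by
  have hx' : x ∈ X.erase v := Finset.mem_erase.2 ⟨hxv, (Finset.mem_inter.1 hx).1⟩
  have hxC : x ∈ comp (X.erase v) x := mem_comp.2 ⟨hx', .refl⟩
  exact ⟨_, mem_branches.2 ⟨⟨x, hx', rfl⟩, x, Finset.mem_inter.2 ⟨hxC, (Finset.mem_inter.1 hx).2⟩⟩,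
    hxC⟩

theorem sum_card_sdiff_branches (R X : Finset M) (v : M) :
    ∑ C ∈ branches R X v, (C \ R).card ≤ ((X.erase v) \ R).card := by
  rw [← Finset.card_biUnion]
  · refine Finset.card_le_card fun x hx => ?_
    obtain ⟨C, hC, hxC⟩ := Finset.mem_biUnion.1 hx
    rw [Finset.mem_sdiff] at hxC ⊢
    exact ⟨subset_of_mem_branches hC hxC.1, hxC.2⟩
  · intro C hC C' hC' hne
    rw [Function.onFun, Finset.disjoint_left]
    intro x hx hx'
    exact hne (eq_of_mem_branches hC hC' (Finset.mem_sdiff.1 hx).1 (Finset.mem_sdiff.1 hx').1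
      (by simp))

end Metric

theorem sum_biUnion_le {β γ : Type*} [DecidableEq γ] (I : Finset β) (H : β → Finset γ) (c : γ → ℕ) :
    ∑ U ∈ I.biUnion H, c U ≤ ∑ C ∈ I, ∑ U ∈ H C, c U := by
  induction I using Finset.induction_on with
  | empty => simp
  | insert a I ha ih =>
    rw [Finset.biUnion_insert, Finset.sum_insert ha]
    have := Finset.sum_union_inter (s₁ := H a) (s₂ := I.biUnion H) (f := c)
    omega

theorem sum_insert_le {γ : Type*} [DecidableEq γ] (U : γ) (H : Finset γ) (c : γ → ℕ) :
    ∑ V ∈ insert U H, c V ≤ c U + ∑ V ∈ H, c V := by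
  by_cases h : U ∈ H
  · rw [Finset.insert_eq_of_mem h]; omega
  · rw [Finset.sum_insert h]

variable {E : Type*} [NormedAddCommGroup E]

/-- A decomposition, in phases `0, …, r`, of a connected set `X` of points with root `v`: in the
phase `j`, the parts with the terminal sets `H j` are complete, and the part with the terminals
`T j` and the further points `B j` contains the root and may still grow. In phase `0`, it is a
path. -/
structure IsScheme (r Δ : ℕ) (R : Finset E) (c : Finset E → ℕ) (X : Finset E) (v : E) (q : ℕ)
    (T B : ℕ → Finset E) (H : ℕ → Finset (Finset E)) : Prop where
  nonempty : ∀ j ≤ r, (T j).Nonempty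
  subset : ∀ j ≤ r, T j ⊆ X ∩ R
  card_le : ∀ j ≤ r, (T j).card ≤ Δ ^ j
  root_mem : ∀ j ≤ r, v ∈ T j ∪ B j
  linked : ∀ j ≤ r, IsLinked (T j ∪ B j)
  parts : ∀ j ≤ r, ∀ U ∈ H j, U ⊆ X ∩ R ∧ U.card ≤ Δ ^ r + 1
  spanning : ∀ j ≤ r, ∀ φ : E → ℕ, (∀ U ∈ insert (T j) (H j), ∀ x ∈ U, ∀ y ∈ U, φ x = φ y) →
    ∀ x ∈ X ∩ R, ∀ y ∈ X ∩ R, φ x = φ y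
  card_zero : (B 0).card ≤ q
  cost_zero : (B 0).card + ∑ U ∈ H 0, c U ≤ q + ((B r).card + ∑ U ∈ H r, c U)
  cost : ∑ i ∈ Finset.range r, ((B (i + 1)).card + ∑ U ∈ H (i + 1), c U) + 2 * q ≤
    (r + 2) * (X \ R).card

section Steps

variable {r Δ : ℕ} {R X : Finset E} {c : Finset E → ℕ} {v : E}
  {p : Finset E → E} {q : Finset E → ℕ} {T B : Finset E → ℕ → Finset E}
  {H : Finset E → ℕ → Finset (Finset E)}

/-- A terminal root can belong to several parts at no cost, so the open part of every branch is
completed with `v` added, which explains the `+ 1` in `Δ ^ r + 1`. In phase `0` the branches are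
used in phase `r`: this makes the phases `0` and `r` equally expensive, as required for `q = 0`. -/
theorem isScheme_of_mem (hr : 0 < r) (hc : ∀ T B : Finset E, IsLinked (T ∪ B) → c T ≤ B.card)
    (hΔ : 1 ≤ Δ) (hv : v ∈ X) (hvR : v ∈ R)
    (hd : ∀ C ∈ branches R X v, dist (p C) v ≤ 1)
    (hs : ∀ C ∈ branches R X v, IsScheme r Δ R c C (p C) (q C) (T C) (B C) (H C)) :
    IsScheme r Δ R c X v 0 (fun _ => {v}) (fun _ => ∅) (fun j =>
      (branches R X v).biUnion fun C =>
        insert (insert v (T C (if j = 0 then r else j))) (H C (if j = 0 then r else j))) := by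
  have hvXR : v ∈ X ∩ R := Finset.mem_inter.2 ⟨hv, hvR⟩
  have hCX : ∀ C ∈ branches R X v, C ∩ R ⊆ X ∩ R := fun C hC =>
    Finset.inter_subset_inter_right ((subset_of_mem_branches hC).trans (Finset.erase_subset _ _))
  have hj : ∀ j ≤ r, (if j = 0 then r else j) ≤ r := by intro j hj; split_ifs <;> omega
  refine ⟨by simp, by simpa using fun _ _ => hvXR, fun j _ => ?_, by simp, fun j _ => ?_, ?_, ?_,
    by simp, by simp [hr.ne'], ?_⟩
  · simpa using Nat.one_le_pow _ _ hΔ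
  · simpa using isLinked_singleton v
  · intro j hjr U hU
    obtain ⟨C, hC, hU⟩ := Finset.mem_biUnion.1 hU
    have hC' := hs C hC
    rcases Finset.mem_insert.1 hU with rfl | hU
    · refine ⟨Finset.insert_subset hvXR ((hC'.subset _ (hj j hjr)).trans (hCX C hC)), ?_⟩
      refine (Finset.card_insert_le _ _).trans (Nat.add_le_add_right ?_ 1)
      exact (hC'.card_le _ (hj j hjr)).trans (Nat.pow_le_pow_right hΔ (hj j hjr))
    · obtain ⟨h1, h2⟩ := hC'.parts _ (hj j hjr) U hU
      exact ⟨h1.trans (hCX C hC), h2⟩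
  · intro j hjr φ hφ
    suffices h : ∀ x ∈ X ∩ R, φ x = φ v from fun x hx y hy => (h x hx).trans (h y hy).symm
    intro x hx
    by_cases hxv : x = v
    · rw [hxv]
    obtain ⟨C, hC, hxC⟩ := exists_branch hx hxv
    have hC' := hs C hC
    have h1 := hφ (insert v (T C (if j = 0 then r else j))) (Finset.mem_insert_of_mem
      (Finset.mem_biUnion.2 ⟨C, hC, Finset.mem_insert_self _ _⟩))
    obtain ⟨y, hy⟩ := hC'.nonempty _ (hj j hjr)
    rw [← h1 y (Finset.mem_insert_of_mem hy) v (Finset.mem_insert_self _ _)]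
    refine hC'.spanning _ (hj j hjr) φ (fun U hU => ?_) x
      (Finset.mem_inter.2 ⟨hxC, (Finset.mem_inter.1 hx).2⟩) y (hC'.subset _ (hj j hjr) hy)
    rcases Finset.mem_insert.1 hU with rfl | hU
    · exact fun a ha b hb => h1 a (Finset.mem_insert_of_mem ha) b (Finset.mem_insert_of_mem hb)
    · exact hφ U (Finset.mem_insert_of_mem
        (Finset.mem_biUnion.2 ⟨C, hC, Finset.mem_insert_of_mem hU⟩))
  · have h1 : ∀ i ∈ Finset.range r, (∅ : Finset E).card + ∑ U ∈ (branches R X v).biUnion (fun C =>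
        insert (insert v (T C (if i + 1 = 0 then r else i + 1)))
          (H C (if i + 1 = 0 then r else i + 1))), c U ≤
        ∑ C ∈ branches R X v, ((B C (i + 1)).card + ∑ U ∈ H C (i + 1), c U) := by
      intro i hi
      have hir : i + 1 ≤ r := Finset.mem_range.1 hi
      rw [Finset.card_empty, zero_add]
      refine (sum_biUnion_le _ _ _).trans (Finset.sum_le_sum fun C hC => ?_)
      refine (sum_insert_le _ _ _).trans ?_
      simp only [Nat.succ_ne_zero, if_false]
      have hC' := hs C hC
      have := hc (insert v (T C (i + 1))) (B C (i + 1)) (by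
        rw [Finset.insert_union]
        exact (hC'.linked _ hir).insert (hC'.root_mem _ hir) (hd C hC))
      omega
    have h2 := Finset.sum_le_sum h1
    rw [Finset.sum_comm] at h2
    have h3 : ∑ C ∈ branches R X v, ∑ i ∈ Finset.range r,
        ((B C (i + 1)).card + ∑ U ∈ H C (i + 1), c U) ≤
        ∑ C ∈ branches R X v, (r + 2) * (C \ R).card :=
      Finset.sum_le_sum fun C hC => by
        have := (hs C hC).cost
        omega
    rw [← Finset.mul_sum] at h3
    have h4 := sum_card_sdiff_branches R X v
    have h5 : (X.erase v \ R).card ≤ (X \ R).card :=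
      Finset.card_le_card (Finset.sdiff_subset_sdiff (Finset.erase_subset _ _) subset_rfl)
    have h6 := Nat.mul_le_mul_left (r + 2) (h4.trans h5)
    rw [mul_zero, add_zero]
    exact h2.trans (h3.trans h6)

/-- A Steiner root joins the open parts of all branches, in their phases `s j`. In phase `0` the
part that would be open in phase `r` is completed instead, and a new open part starts: the path of
the branch `C₀`, prolonged by `v`. Only this path is paid for in addition. -/
theorem isScheme_of_notMem (hr : 0 < r) (hc : ∀ T B : Finset E, IsLinked (T ∪ B) → c T ≤ B.card)
    (hv : v ∈ X) (hvR : v ∉ R)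
    (hd : ∀ C ∈ branches R X v, dist (p C) v ≤ 1)
    (hs : ∀ C ∈ branches R X v, IsScheme r Δ R c C (p C) (q C) (T C) (B C) (H C))
    {C₀ : Finset E} (hC₀ : C₀ ∈ branches R X v) (s : ℕ → ℕ) (hsr : ∀ j ≤ r, s j ≤ r)
    (hcard : ∀ j, 0 < j → (branches R X v).card * Δ ^ s j ≤ Δ ^ j)
    (hcost : ∑ i ∈ Finset.range r, (1 + ∑ C ∈ branches R X v,
      ((B C (s (i + 1))).card + ∑ U ∈ H C (s (i + 1)), c U)) + 2 * (q C₀ + 1) ≤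
      (r + 2) * (∑ C ∈ branches R X v, (C \ R).card + 1)) :
    IsScheme r Δ R c X v (q C₀ + 1)
      (fun j => if j = 0 then T C₀ 0 else (branches R X v).biUnion fun C => T C (s j))
      (fun j => insert v (if j = 0 then B C₀ 0 else (branches R X v).biUnion fun C => B C (s j)))
      (fun j => if j = 0 then insert ((branches R X v).biUnion fun C => T C (s r))
        ((branches R X v).biUnion fun C => H C (s r))
        else (branches R X v).biUnion fun C => H C (s j)) := by
  have hCX : ∀ C ∈ branches R X v, C ∩ R ⊆ X ∩ R := fun C hC =>
    Finset.inter_subset_inter_right ((subset_of_mem_branches hC).trans (Finset.erase_subset _ _))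
  have hs₀ := hs C₀ hC₀
  have hTsub : ∀ j ≤ r, ((branches R X v).biUnion fun C => T C (s j)) ⊆ X ∩ R := fun j hj =>
    Finset.biUnion_subset.2 fun C hC => ((hs C hC).subset _ (hsr j hj)).trans (hCX C hC)
  have hTcard : ∀ j, 0 < j → j ≤ r →
      ((branches R X v).biUnion fun C => T C (s j)).card ≤ Δ ^ j := fun j h0 hj =>
    (Finset.card_biUnion_le_card_mul _ _ _ fun C hC => (hs C hC).card_le _ (hsr j hj)).trans
      (hcard j h0)
  have hlink : ∀ j ≤ r, IsLinked (((branches R X v).biUnion fun C => T C (s j)) ∪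
      insert v ((branches R X v).biUnion fun C => B C (s j))) := by
    intro j hj
    rw [Finset.union_insert, ← Finset.biUnion_union]
    exact isLinked_insert_biUnion _ _ p v (fun C hC => (hs C hC).linked _ (hsr j hj))
      (fun C hC => (hs C hC).root_mem _ (hsr j hj)) hd
  have hparts : ∀ j ≤ r, ∀ U ∈ (branches R X v).biUnion fun C => H C (s j),
      U ⊆ X ∩ R ∧ U.card ≤ Δ ^ r + 1 := by
    intro j hj U hU
    obtain ⟨C, hC, hU⟩ := Finset.mem_biUnion.1 hU
    obtain ⟨h1, h2⟩ := (hs C hC).parts _ (hsr j hj) U hU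
    exact ⟨h1.trans (hCX C hC), h2⟩
  have hspan : ∀ j ≤ r, ∀ φ : E → ℕ,
      (∀ U ∈ insert ((branches R X v).biUnion fun C => T C (s j))
        ((branches R X v).biUnion fun C => H C (s j)), ∀ x ∈ U, ∀ y ∈ U, φ x = φ y) →
      ∀ x ∈ X ∩ R, ∀ y ∈ X ∩ R, φ x = φ y := by
    intro j hj φ hφ
    have h1 := hφ _ (Finset.mem_insert_self _ _)
    have key : ∀ x ∈ X ∩ R, ∃ y ∈ (branches R X v).biUnion fun C => T C (s j), φ x = φ y := by
      intro x hx
      obtain ⟨C, hC, hxC⟩ := exists_branch (v := v) hx (by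
        rintro rfl; exact hvR (Finset.mem_inter.1 hx).2)
      have hC' := hs C hC
      obtain ⟨y, hy⟩ := hC'.nonempty _ (hsr j hj)
      refine ⟨y, Finset.mem_biUnion.2 ⟨C, hC, hy⟩, ?_⟩
      refine hC'.spanning _ (hsr j hj) φ (fun U hU => ?_) x
        (Finset.mem_inter.2 ⟨hxC, (Finset.mem_inter.1 hx).2⟩) y (hC'.subset _ (hsr j hj) hy)
      rcases Finset.mem_insert.1 hU with rfl | hU
      · exact fun a ha b hb => h1 a (Finset.mem_biUnion.2 ⟨C, hC, ha⟩) b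
          (Finset.mem_biUnion.2 ⟨C, hC, hb⟩)
      · exact hφ U (Finset.mem_insert_of_mem (Finset.mem_biUnion.2 ⟨C, hC, hU⟩))
    intro x hx y hy
    obtain ⟨x', hx', e1⟩ := key x hx
    obtain ⟨y', hy', e2⟩ := key y hy
    rw [e1, e2, h1 x' hx' y' hy']
  refine ⟨?_, ?_, ?_, ?_, ?_, ?_, ?_, ?_, ?_, ?_⟩
  · intro j hj
    split_ifs
    · exact hs₀.nonempty 0 (Nat.zero_le _)
    · exact ⟨_, Finset.mem_biUnion.2 ⟨C₀, hC₀, (hs₀.nonempty _ (hsr j hj)).choose_spec⟩⟩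
  · intro j hj
    split_ifs
    · exact (hs₀.subset 0 (Nat.zero_le _)).trans (hCX _ hC₀)
    · exact hTsub j hj
  · intro j hj
    split_ifs with h
    · rw [h]; exact hs₀.card_le 0 (Nat.zero_le _)
    · exact hTcard j (Nat.pos_of_ne_zero h) hj
  · intro j hj
    exact Finset.mem_union_right _ (Finset.mem_insert_self _ _)
  · intro j hj
    split_ifs with h
    · rw [Finset.union_insert]
      exact (hs₀.linked 0 (Nat.zero_le _)).insert (hs₀.root_mem 0 (Nat.zero_le _)) (hd _ hC₀)
    · exact hlink j hj
  · intro j hj U hU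
    split_ifs at hU with h
    · rcases Finset.mem_insert.1 hU with rfl | hU
      · exact ⟨hTsub r le_rfl, (hTcard r hr le_rfl).trans (Nat.le_succ _)⟩
      · exact hparts r le_rfl U hU
    · exact hparts j hj U hU
  · intro j hj φ hφ
    split_ifs at hφ with h
    · exact hspan r le_rfl φ fun U hU => hφ U (Finset.mem_insert_of_mem hU)
    · exact hspan j hj φ hφ
  · simp only [if_true]
    exact (Finset.card_insert_le _ _).trans (Nat.add_le_add_right hs₀.card_zero 1)
  · simp only [if_true, hr.ne', if_false]
    have h1 := (Finset.card_insert_le v (B C₀ 0)).trans (Nat.add_le_add_right hs₀.card_zero 1)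
    have h2 := sum_insert_le ((branches R X v).biUnion fun C => T C (s r))
      ((branches R X v).biUnion fun C => H C (s r)) c
    have h3 := hc _ _ (hlink r le_rfl)
    omega
  · simp only [Nat.succ_ne_zero, if_false]
    have h1 : ∀ i ∈ Finset.range r,
        (insert v ((branches R X v).biUnion fun C => B C (s (i + 1)))).card +
        ∑ U ∈ (branches R X v).biUnion (fun C => H C (s (i + 1))), c U ≤
        1 + ∑ C ∈ branches R X v,
          ((B C (s (i + 1))).card + ∑ U ∈ H C (s (i + 1)), c U) := by
      intro i _
      have h2 := Finset.card_insert_le v ((branches R X v).biUnion fun C => B C (s (i + 1)))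
      have h3 := sum_biUnion_le (branches R X v) (fun C => H C (s (i + 1))) c
      have h4 : ((branches R X v).biUnion fun C => B C (s (i + 1))).card ≤ _ :=
        Finset.card_biUnion_le
      rw [Finset.sum_add_distrib]
      omega
    have h2 := Finset.sum_le_sum h1
    have h3 : ∑ C ∈ branches R X v, (C \ R).card + 1 ≤ (X \ R).card := by
      have h4 := sum_card_sdiff_branches R X v
      have h5 : X \ R = insert v (X.erase v \ R) := by
        ext x
        simp only [Finset.mem_sdiff, Finset.mem_insert, Finset.mem_erase]
        by_cases hx : x = v
        · subst hx; simp [hv, hvR]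
        · simp [hx]
      rw [h5, Finset.card_insert_of_notMem (by simp)]
      omega
    have h4 := Nat.mul_le_mul_left (r + 2) h3
    omega

end Steps

/-- Induction on the size of `X`, splitting at the root. The term `2 * q` in `cost` is a potential
that pays for the paths. At a root with several branches the phases shift by one, so phase `0` of a
branch replaces its phase `r`, at an extra cost of at most `q C`. This consumes half of each `2 * q
C`; the other halves of at least two branches cover `2 * q C₀` as `q C₀` is minimal. The root itself
contributes `r` points over the phases and `2` to the new potential, which is one share `r + 2`. -/
theorem exists_isScheme {Δ : ℕ} (hΔ : IsIndependenceNumber E Δ) {r : ℕ} (hr : 0 < r)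
    {R : Finset E} {c : Finset E → ℕ}
    (hc : ∀ T B : Finset E, IsLinked (T ∪ B) → c T ≤ B.card) (hΔ1 : 1 ≤ Δ) (m : ℕ) :
    ∀ (X : Finset E) (v : E), X.card = m → v ∈ X → IsLinked X → (X ∩ R).Nonempty →
      ∃ q T B H, IsScheme r Δ R c X v q T B H := by
  induction m using Nat.strong_induction_on with
  | _ m ih =>
  intro X v hm hv hX hXR
  have hbr : ∀ C ∈ branches R X v, ∃ p q T B H, p ∈ C ∧ dist p v ≤ 1 ∧
      IsScheme r Δ R c C p q T B H := by
    intro C hC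
    obtain ⟨⟨x, hx, rfl⟩, hCR⟩ := mem_branches.1 hC
    obtain ⟨p, hp, hpv⟩ := exists_mem_comp_erase hX hv hx
    have hlt : (comp (X.erase v) x).card < m := by
      have h1 := Finset.card_le_card (subset_of_mem_branches hC)
      have h2 := Finset.card_erase_lt_of_mem hv
      omega
    obtain ⟨q, T, B, H, h⟩ := ih _ hlt _ p rfl hp (isLinked_comp hx) hCR
    exact ⟨p, q, T, B, H, hp, hpv, h⟩
  choose! p q T B H hp hd hs using hbr
  by_cases hvR : v ∈ R
  · exact ⟨_, _, _, _, isScheme_of_mem hr hc hΔ1 hv hvR hd hs⟩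
  have hne : (branches R X v).Nonempty := by
    obtain ⟨x, hx⟩ := hXR
    obtain ⟨C, hC, _⟩ := exists_branch (v := v) hx (by
      rintro rfl; exact hvR (Finset.mem_inter.1 hx).2)
    exact ⟨C, hC⟩
  -- The roots of different branches lie within distance one of `v` and more than one apart.
  have hdeg : (branches R X v).card ≤ Δ := by
    refine hΔ.card_le _ p v hd fun C hC C' hC' hne => ?_
    by_contra! h
    exact hne (eq_of_mem_branches hC hC' (hp C hC) (hp C' hC') h)
  obtain ⟨C₀, hC₀, hmin⟩ := Finset.exists_min_image _ q hne
  rcases Nat.lt_or_ge 1 (branches R X v).card with h1 | h1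
  -- With several branches the number of open terminals can grow by a factor `Δ`, so phase `j` must
  -- come from phase `j - 1`.
  · refine ⟨_, _, _, _, isScheme_of_notMem hr hc hv hvR hd hs hC₀ (fun j => j - 1)
      (fun j hj => by omega) (fun j hj => ?_) ?_⟩
    · obtain ⟨i, rfl⟩ : ∃ i, j = i + 1 := ⟨j - 1, by omega⟩
      rw [Nat.add_sub_cancel, pow_succ, mul_comm]
      exact Nat.mul_le_mul_left _ hdeg
    · simp only [Nat.add_sub_cancel]
      rw [Finset.sum_add_distrib, Finset.sum_comm, Finset.sum_const, Finset.card_range,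
        smul_eq_mul, mul_one]
      have h2 : ∀ C ∈ branches R X v, ∑ i ∈ Finset.range r, ((B C i).card + ∑ U ∈ H C i, c U) +
          q C ≤ (r + 2) * (C \ R).card := by
        intro C hC
        have h3 := (hs C hC).cost
        have h4 := (hs C hC).cost_zero
        have h5 := Finset.sum_range_succ (fun i => (B C i).card + ∑ U ∈ H C i, c U) r
        have h6 := Finset.sum_range_succ' (fun i => (B C i).card + ∑ U ∈ H C i, c U) r
        omega
      have h3 := Finset.sum_le_sum h2
      rw [Finset.sum_add_distrib, ← Finset.mul_sum] at h3
      have h4 : (branches R X v).card * q C₀ ≤ ∑ C ∈ branches R X v, q C := by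
        rw [← smul_eq_mul]
        exact Finset.card_nsmul_le_sum _ _ _ hmin
      have h5 : 2 * q C₀ ≤ (branches R X v).card * q C₀ := Nat.mul_le_mul_right _ h1
      rw [mul_add, mul_one, mul_add]
      omega
  · have hone : branches R X v = {C₀} := by
      obtain ⟨C, hC⟩ := Finset.card_eq_one.1 (le_antisymm h1 (Finset.card_pos.2 hne))
      rw [hC] at hC₀ ⊢
      rw [Finset.mem_singleton.1 hC₀]
    -- With a single branch no terminals are gathered and the phases need not shift.
    refine ⟨_, _, _, _, isScheme_of_notMem hr hc hv hvR hd hs hC₀ (fun j => j)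
      (fun j hj => hj) (fun j hj => ?_) ?_⟩
    · simp [hone]
    · have h3 := (hs C₀ hC₀).cost
      simp only [hone, Finset.sum_singleton]
      rw [Finset.sum_add_distrib, Finset.sum_const, Finset.card_range, smul_eq_mul, mul_one,
        mul_add, mul_one, mul_add]
      omega

/-- Every solution can be replaced by parts with a bounded number of terminals, at a small loss. -/
theorem exists_restricted {Δ : ℕ} (hΔ : IsIndependenceNumber E Δ) (hΔ1 : 1 ≤ Δ) {r : ℕ}
    (hr : 0 < r) {R S : Finset E} (h : ∀ x ∈ R, ∀ y ∈ R, Linked 1 (↑(R ∪ S) : Set E) x y)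
    {c : Finset E → ℕ} (hc : ∀ T B : Finset E, IsLinked (T ∪ B) → c T ≤ B.card) :
    ∃ H : Finset (Finset E), (∀ U ∈ H, U ⊆ R ∧ U.card ≤ Δ ^ r + 1) ∧
      (∀ φ : E → ℕ, (∀ U ∈ H, ∀ x ∈ U, ∀ y ∈ U, φ x = φ y) → ∀ x ∈ R, ∀ y ∈ R, φ x = φ y) ∧
      r * ∑ U ∈ H, c U ≤ (r + 2) * S.card := by
  rcases R.eq_empty_or_nonempty with rfl | ⟨v, hv⟩
  · exact ⟨∅, by simp⟩
  have hvX : v ∈ comp (R ∪ S) v := mem_comp.2 ⟨Finset.mem_union_left _ hv, .refl⟩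
  have hRX : R ⊆ comp (R ∪ S) v := fun x hx =>
    mem_comp.2 ⟨Finset.mem_union_left _ hx, h v hv x hx⟩
  obtain ⟨q, T, B, H, hs⟩ := exists_isScheme hΔ hr hc hΔ1 _ _ v rfl hvX
    (isLinked_comp (Finset.mem_union_left _ hv)) ⟨v, Finset.mem_inter.2 ⟨hvX, hv⟩⟩
  have hcost := hs.cost
  have hcard : (comp (R ∪ S) v \ R).card ≤ S.card := by
    refine Finset.card_le_card fun x hx => ?_
    rw [Finset.mem_sdiff, mem_comp, Finset.mem_union] at hx
    tauto
  -- The cheapest of the phases `1, …, r` costs at most their average.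
  obtain ⟨i, hi, hle⟩ : ∃ i ∈ Finset.range r,
      r * ((B (i + 1)).card + ∑ U ∈ H (i + 1), c U) ≤ (r + 2) * S.card := by
    by_contra! hno
    have h1 := Finset.sum_lt_sum_of_nonempty (Finset.nonempty_range_iff.2 hr.ne') hno
    rw [Finset.sum_const, Finset.card_range, smul_eq_mul, ← Finset.mul_sum] at h1
    have h2 := Nat.lt_of_mul_lt_mul_left h1
    have h3 := Nat.mul_le_mul_left (r + 2) hcard
    omega
  have hir : i + 1 ≤ r := Finset.mem_range.1 hi
  have hXR : comp (R ∪ S) v ∩ R = R := Finset.inter_eq_right.2 hRX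
  refine ⟨insert (T (i + 1)) (H (i + 1)), fun U hU => ?_, ?_, ?_⟩
  · rcases Finset.mem_insert.1 hU with rfl | hU
    · refine ⟨(hs.subset _ hir).trans Finset.inter_subset_right, (hs.card_le _ hir).trans ?_⟩
      exact (Nat.pow_le_pow_right hΔ1 hir).trans (Nat.le_succ _)
    · obtain ⟨h1, h2⟩ := hs.parts _ hir U hU
      exact ⟨h1.trans Finset.inter_subset_right, h2⟩
  · intro φ hφ
    have := hs.spanning _ hir φ hφ
    rwa [hXR] at this
  · refine (Nat.mul_le_mul_left r ?_).trans hle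
    exact (sum_insert_le _ _ _).trans (Nat.add_le_add_right (hc _ _ (hs.linked _ hir)) _)

end Restricted

section Plane

/-! ### The Euclidean plane -/

/-- Law of cosines: at an angle of at most `π / 3` the squared distance is at most `x² + y² - x *
y`, which is at most `1` for lengths `x, y ≤ 1`. Arguments are measured from `z₀`, to place a chosen
point at angle zero. -/
theorem norm_sub_le_one_of_arg {z₀ z w : ℂ} (h₀ : z₀ ≠ 0) (hz : ‖z‖ ≤ 1)
    (hw : ‖w‖ ≤ 1) (h : |(z / z₀).arg - (w / z₀).arg| ≤ Real.pi / 3) : ‖z - w‖ ≤ 1 := by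
  have hcos : 1 / 2 ≤ Real.cos ((z / z₀).arg - (w / z₀).arg) := by
    rw [← Real.cos_pi_div_three, ← Real.cos_abs ((z / z₀).arg - (w / z₀).arg)]
    exact Real.cos_le_cos_of_nonneg_of_le_pi (abs_nonneg _) (by linarith [Real.pi_pos]) h
  set a := z / z₀ with ha
  set b := w / z₀ with hb
  have hza : z = z₀ * a := by rw [ha]; field_simp
  have hwb : w = z₀ * b := by rw [hb]; field_simp
  have hab : ‖a - b‖ ^ 2 ≤ ‖a‖ ^ 2 + ‖b‖ ^ 2 - ‖a‖ * ‖b‖ := by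
    have h1 : ‖a - b‖ ^ 2 = (a.re - b.re) ^ 2 + (a.im - b.im) ^ 2 := by
      rw [← Complex.normSq_eq_norm_sq, Complex.normSq_apply]; simp; ring
    have h2 : ‖a‖ ^ 2 = a.re ^ 2 + a.im ^ 2 := by
      rw [← Complex.normSq_eq_norm_sq, Complex.normSq_apply]; ring
    have h3 : ‖b‖ ^ 2 = b.re ^ 2 + b.im ^ 2 := by
      rw [← Complex.normSq_eq_norm_sq, Complex.normSq_apply]; ring
    have h4 : a.re * b.re + a.im * b.im = ‖a‖ * ‖b‖ * Real.cos (a.arg - b.arg) := by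
      rw [Real.cos_sub, ← Complex.norm_mul_cos_arg a, ← Complex.norm_mul_cos_arg b,
        ← Complex.norm_mul_sin_arg a, ← Complex.norm_mul_sin_arg b]
      ring
    have h5 : ‖a‖ * ‖b‖ * (1 / 2) ≤ ‖a‖ * ‖b‖ * Real.cos (a.arg - b.arg) := by gcongr
    nlinarith
  have hn1 : ‖z‖ = ‖z₀‖ * ‖a‖ := by rw [hza, norm_mul]
  have hn2 : ‖w‖ = ‖z₀‖ * ‖b‖ := by rw [hwb, norm_mul]
  have hn3 : ‖z - w‖ = ‖z₀‖ * ‖a - b‖ := by rw [hza, hwb, ← mul_sub, norm_mul]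
  have h6 : ‖z - w‖ ^ 2 ≤ ‖z‖ ^ 2 + ‖w‖ ^ 2 - ‖z‖ * ‖w‖ := by
    have := mul_le_mul_of_nonneg_left hab (sq_nonneg ‖z₀‖)
    rw [hn1, hn2, hn3]
    nlinarith
  have h7 : ‖z‖ ^ 2 + ‖w‖ ^ 2 - ‖z‖ * ‖w‖ ≤ 1 := by
    nlinarith [norm_nonneg z, norm_nonneg w, mul_nonneg (norm_nonneg z) (sub_nonneg.2 hz),
      mul_nonneg (norm_nonneg w) (sub_nonneg.2 hw), mul_nonneg (sub_nonneg.2 hz) (sub_nonneg.2 hw)]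
  exact (sq_le_one_iff₀ (norm_nonneg _)).1 (h6.trans h7)

/-- Given six points, the five others have angle more than `π / 3` from `z₀`. What remains of the
circle is covered by four sectors of angle at most `π / 3`, so two of the five share a sector and
are too close. -/
theorem card_le_five {s : Finset ℂ} (h1 : ∀ z ∈ s, ‖z‖ ≤ 1)
    (h2 : ∀ z ∈ s, ∀ w ∈ s, z ≠ w → 1 < ‖z - w‖) : s.card ≤ 5 := by
  by_contra! hcard
  have hne : ∀ z ∈ s, z ≠ 0 := by
    rintro z hz rfl
    obtain ⟨w, hw, hwz⟩ := Finset.exists_mem_ne (show 1 < s.card by omega) (0 : ℂ)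
    have h3 := h2 w hw 0 hz hwz
    rw [sub_zero] at h3
    exact (h1 w hw).not_gt h3
  obtain ⟨z₀, hz₀⟩ := Finset.card_pos.1 (show 0 < s.card by omega)
  have h₀ := hne z₀ hz₀
  let f : ℂ → Fin 4 := fun z =>
    if (z / z₀).arg ≤ -(2 * Real.pi / 3) then 0 else if (z / z₀).arg ≤ 0 then 1 else
      if (z / z₀).arg ≤ 2 * Real.pi / 3 then 2 else 3
  obtain ⟨z, hz, w, hw, hzw, hf⟩ := Finset.exists_ne_map_eq_of_card_lt_of_maps_to
    (s := s.erase z₀) (t := Finset.univ) (f := f) (by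
      rw [Finset.card_erase_of_mem hz₀, Finset.card_univ, Fintype.card_fin]; omega) (by simp)
  rw [Finset.mem_erase] at hz hw
  have far : ∀ z, z ≠ z₀ ∧ z ∈ s → Real.pi / 3 < |(z / z₀).arg| := by
    intro z hz
    by_contra! h
    refine (h2 z hz.2 z₀ hz₀ hz.1).not_ge (norm_sub_le_one_of_arg h₀ (h1 z hz.2) (h1 z₀ hz₀) ?_)
    rwa [div_self h₀, Complex.arg_one, sub_zero]
  have hz1 := far z hz
  have hw1 := far w hw
  have hz2 := Complex.neg_pi_lt_arg (z / z₀)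
  have hz3 := Complex.arg_le_pi (z / z₀)
  have hw2 := Complex.neg_pi_lt_arg (w / z₀)
  have hw3 := Complex.arg_le_pi (w / z₀)
  refine (h2 z hz.2 w hw.2 hzw).not_ge
    (norm_sub_le_one_of_arg h₀ (h1 z hz.2) (h1 w hw.2) (abs_le.2 ?_))
  have hpi := Real.pi_pos
  rw [lt_abs] at hz1 hw1
  simp only [f] at hf
  split_ifs at hf <;>
    first
    | exact absurd hf (by decide)
    | (rcases hz1 with hz1 | hz1 <;> rcases hw1 with hw1 | hw1 <;> constructor <;> linarith)

/-- Five points of the unit disk at pairwise distance larger than one. -/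
noncomputable def fivePoints (i : Fin 5) : EuclideanSpace ℝ (Fin 2) :=
  -- A rational approximation of the regular pentagon inscribed in the unit circle.
  !₂[(![1, 3 / 10, -4 / 5, -4 / 5, 3 / 10] : Fin 5 → ℝ) i,
    (![0, 19 / 20, 29 / 50, -29 / 50, -19 / 20] : Fin 5 → ℝ) i]

theorem one_lt_dist_fivePoints {i j : Fin 5} (h : i ≠ j) :
    1 < dist (fivePoints i) (fivePoints j) := by
  rw [EuclideanSpace.dist_eq, Real.lt_sqrt zero_le_one, Fin.sum_univ_two, Real.dist_eq,
    Real.dist_eq, sq_abs, sq_abs]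
  fin_cases i <;> fin_cases j <;> first | exact absurd rfl h | norm_num [fivePoints]

theorem isIndependenceNumber_plane : IsIndependenceNumber (EuclideanSpace ℝ (Fin 2)) 5 := by
  classical
  constructor
  · refine ⟨Finset.univ.image fivePoints, ?_, ?_, ?_⟩
    · intro x hx
      obtain ⟨i, _, rfl⟩ := Finset.mem_image.1 (Finset.mem_coe.1 hx)
      rw [mem_closedBall_zero_iff, EuclideanSpace.norm_eq, Real.sqrt_le_left zero_le_one, one_pow, Fin.sum_univ_two,
        Real.norm_eq_abs, Real.norm_eq_abs, sq_abs, sq_abs]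
      fin_cases i <;> norm_num [fivePoints]
    · intro x hx y hy hxy
      obtain ⟨i, _, rfl⟩ := Finset.mem_image.1 (Finset.mem_coe.1 hx)
      obtain ⟨j, _, rfl⟩ := Finset.mem_image.1 (Finset.mem_coe.1 hy)
      exact one_lt_dist_fivePoints (by rintro rfl; exact hxy rfl)
    · rw [Finset.card_image_of_injective]
      · simp
      · intro i j hij
        by_contra hne
        have := one_lt_dist_fivePoints hne
        rw [hij, dist_self] at this
        linarith
  · rintro n ⟨s, hs1, hs2, rfl⟩
    set e := Complex.orthonormalBasisOneI.repr.symm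
    rw [← Finset.card_image_of_injective s e.injective]
    refine card_le_five (fun z hz => ?_) fun z hz w hw hzw => ?_
    · obtain ⟨x, hx, rfl⟩ := Finset.mem_image.1 hz
      rw [e.norm_map]
      exact mem_closedBall_zero_iff.1 (hs1 hx)
    · obtain ⟨x, hx, rfl⟩ := Finset.mem_image.1 hz
      obtain ⟨y, hy, rfl⟩ := Finset.mem_image.1 hw
      rw [← dist_eq_norm, e.dist_map]
      exact hs2 hx hy (by rintro rfl; exact hzw rfl)

end Plane

section Correctness

/-! ### Correctness of the greedy algorithm -/

open scoped Classical

section Metric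

variable {M : Type*} [MetricSpace M]

/-- Distinct nodes at the same location are at distance zero, hence adjacent, so feasibility depends
only on the set of points and not on multiplicities. -/
theorem feasible_iff {R : Finset M} {S : List M} :
    Feasible R S ↔ ∀ x ∈ R, ∀ y ∈ R, Linked 1 {z | z ∈ R ∨ z ∈ S} x y := by
  have hmem : ∀ i, placement R S i ∈ {z | z ∈ R ∨ z ∈ S} := by
    rintro (i | i)
    · exact Or.inl i.2
    · exact Or.inr (List.get_mem _ _)
  have hsurj : ∀ z ∈ {z | z ∈ R ∨ z ∈ S}, ∃ i, placement R S i = z := by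
    rintro z (hz | hz)
    · exact ⟨Sum.inl ⟨z, hz⟩, rfl⟩
    · obtain ⟨i, hi⟩ := List.get_of_mem hz
      exact ⟨Sum.inr i, hi⟩
  constructor
  · intro h x hx y hy
    have := (SimpleGraph.reachable_iff_reflTransGen _ _).1 (h ⟨x, hx⟩ ⟨y, hy⟩)
    exact Relation.ReflTransGen.lift (placement R S)
      (fun a b hab => ⟨hmem a, hmem b, hab.2⟩) _ _ this
  · intro h u v
    have adj : ∀ i j, dist (placement R S i) (placement R S j) ≤ 1 →
        (unitDiskGraph (placement R S)).Reachable i j := by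
      intro i j hij
      by_cases hne : i = j
      · rw [hne]
      · exact SimpleGraph.Adj.reachable ⟨hne, hij⟩
    have key : ∀ y, Linked 1 {z | z ∈ R ∨ z ∈ S} (u : M) y → ∀ j, placement R S j = y →
        (unitDiskGraph (placement R S)).Reachable (Sum.inl u) j := by
      intro y hy
      induction hy with
      | refl =>
        intro j hj
        refine adj _ _ ?_
        rw [hj]
        simp [placement]
      | tail _ hbc ih =>
        intro j hj
        obtain ⟨i, hi⟩ := hsurj _ hbc.1
        exact (ih i hi).trans (adj i j (by rw [hi, hj]; exact hbc.2.2))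
    exact key v (h u u.2 v v.2) (Sum.inl v) rfl

/-- The minimum number of points of a feasible solution. -/
noncomputable def minCost (U : Finset M) : ℕ := sInf {m | ∃ S, Feasible U S ∧ S.length = m}

theorem minCost_le {T B : Finset M} (h : IsLinked (T ∪ B)) : minCost T ≤ B.card := by
  refine Nat.sInf_le ⟨B.toList, feasible_iff.2 fun x hx y hy => ?_, Finset.length_toList _⟩
  refine (h x (Finset.mem_union_left _ hx) y (Finset.mem_union_left _ hy)).mono le_rfl fun z hz => ?_
  simpa using hz

theorem IsOptimal.length_le_minCost {U : Finset M} {S : List M} (h : IsOptimal U S) :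
    S.length ≤ minCost U :=
  le_csInf ⟨_, S, h.1, rfl⟩ (by rintro _ ⟨S', hS', rfl⟩; exact h.2 S' hS')

end Metric

/-- Points are placed along the segment in steps of length at most one; this is the upper bound for
the cost of a pair of terminals. -/
theorem exists_linked_of_dist_le {E : Type*} [NormedAddCommGroup E] [NormedSpace ℝ E] (t : ℕ)
    (a b : E) (h : dist a b ≤ (t : ℝ) + 1) :
    ∃ S : List E, S.length = t ∧ Linked 1 {z | z ∈ ({a, b} : Finset E) ∨ z ∈ S} a b := by
  induction t generalizing b with
  | zero => exact ⟨[], rfl, Linked.of_dist_le (by simp) (by simp) (by simpa using h)⟩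
  | succ t ih =>
    obtain ⟨y, hy1, hy2⟩ := exists_dist_le_le (x := a) (z := b) (ε := 1) (δ := (t : ℝ) + 1)
      (by positivity) zero_le_one (by push_cast at h; linarith)
    obtain ⟨S, hS, hl⟩ := ih y hy1
    refine ⟨y :: S, by simp [hS], (hl.mono le_rfl ?_).trans
      (Linked.of_dist_le (by simp) (by simp) hy2)⟩
    rintro z (hz | hz)
    · rcases Finset.mem_insert.1 hz with rfl | hz
      · simp
      · simp [Finset.mem_singleton.1 hz]
    · exact Or.inr (List.mem_cons_of_mem _ hz)

variable {E : Type*} [NormedAddCommGroup E]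

/-- The points with the indices in `T`. -/
noncomputable def pointsAt (xs : List E) (T : List ℕ) : Finset E :=
  (T.map fun i => xs.getD i 0).toFinset

/-- The component of the point with index `i` in the unit-disk graph of `Y` is a function of `i`
that is constant on every candidate, so it factors through the labels. -/
theorem linked_of_label_eq {α : Type*} {xs : List E} {G : List (Cand α)} {sol : Cand α → List E}
    {Y : Set E} (hG : ∀ e ∈ G, ∀ i ∈ e.1, i < xs.length)
    (hsol : ∀ e ∈ G, Feasible (pointsAt xs e.1) (sol e)) (hY : ∀ x ∈ xs, x ∈ Y)
    (hY' : ∀ e ∈ G, ∀ z ∈ sol e, z ∈ Y)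
    (hlab : ∀ i < xs.length, ∀ j < xs.length,
      label xs.length (G.map fun e => e.1) i = label xs.length (G.map fun e => e.1) j) :
    ∀ x ∈ xs, ∀ y ∈ xs, Linked 1 Y x y := by
  intro x hx y hy
  obtain ⟨i, hi, rfl⟩ := List.getElem_of_mem hx
  obtain ⟨j, hj, rfl⟩ := List.getElem_of_mem hy
  have := eq_of_label_eq (n := xs.length) (H := G.map fun e => e.1) (fun T hT => by
    obtain ⟨e, he, rfl⟩ := List.mem_map.1 hT
    exact hG e he) (fun i => component 1 Y (xs.getD i 0)) (fun T hT => by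
    obtain ⟨e, he, rfl⟩ := List.mem_map.1 hT
    intro i hi j hj
    refine component_eq_iff.2 ((feasible_iff.1 (hsol e he) _ ?_ _ ?_).mono le_rfl ?_)
    · exact List.mem_toFinset.2 (List.mem_map_of_mem (f := fun i => xs.getD i 0) hi)
    · exact List.mem_toFinset.2 (List.mem_map_of_mem (f := fun i => xs.getD i 0) hj)
    · rintro z (hz | hz)
      · obtain ⟨i, hi, rfl⟩ := List.mem_map.1 (List.mem_toFinset.1 hz)
        refine hY _ ?_
        rw [List.getD_eq_getElem _ _ (hG e he i hi)]
        exact List.getElem_mem _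
      · exact hY' e he z hz) hi hj (hlab i hi j hj)
  simp only [component_eq_iff, List.getD_eq_getElem _ _ hi, List.getD_eq_getElem _ _ hj] at this
  exact this

theorem greedy_correct [NormedSpace ℝ E] {Δ : ℕ} (hΔ : IsIndependenceNumber E Δ) (hΔ2 : 2 ≤ Δ)
    {r : ℕ} (hr : 0 < r) {α : Type*} {R : Finset E} {xs : List E} (hxs : (xs : Multiset E) = R.val)
    {cands : List (Cand α)} {sol : Cand α → List E}
    (hsub : ∀ e ∈ cands, e.1.Sublist (List.range xs.length))
    (hall : ∀ T : List ℕ, T.Sublist (List.range xs.length) → T.length ≤ Δ ^ r + 1 →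
      ∃ e ∈ cands, e.1 = T)
    (hopt : ∀ e ∈ cands, IsOptimal (pointsAt xs e.1) (sol e))
    (hlen : ∀ e ∈ cands, e.2.length = (sol e).length) :
    greedy xs.length cands ⊆ cands ∧ Feasible R ((greedy xs.length cands).flatMap sol) ∧
      ∀ S', Feasible R S' →
      (r : ℝ) * ((greedy xs.length cands).flatMap sol).length ≤
        (1 + Real.log ((Δ : ℝ) - 1)) * ((r + 2) * S'.length) := by
  have hmemR : ∀ x, x ∈ R ↔ x ∈ xs := fun x => by
    rw [← Finset.mem_val, ← hxs, Multiset.mem_coe]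
  have hnodup : xs.Nodup := by
    rw [← Multiset.coe_nodup, hxs]; exact R.nodup
  set n := xs.length with hn
  have hc : ∀ e ∈ cands, ∀ i ∈ e.1, i < n := fun e he i hi =>
    List.mem_range.1 ((hsub e he).subset hi)
  have hpt : ∀ i < n, xs.getD i 0 ∈ R := fun i hi => by
    rw [hmemR, List.getD_eq_getElem _ _ hi]; exact List.getElem_mem _
  have hidx : ∀ x ∈ R, xs.idxOf x < n ∧ xs.getD (xs.idxOf x) 0 = x := fun x hx => by
    have h1 := List.idxOf_lt_length_of_mem ((hmemR x).1 hx)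
    exact ⟨h1, by rw [List.getD_eq_getElem _ _ h1, List.getElem_idxOf h1]⟩
  have hidx' : ∀ i < n, xs.idxOf (xs.getD i 0) = i := fun i hi => by
    rw [List.getD_eq_getElem _ _ hi]; exact hnodup.idxOf_getElem i hi
  have hcost : ∀ e ∈ cands, e.2.length ≤ minCost (pointsAt xs e.1) := fun e he => by
    rw [hlen e he]; exact (hopt e he).length_le_minCost
  -- the candidate for a set of terminals
  have hpart : ∀ U : Finset E, U ⊆ R ∧ U.card ≤ Δ ^ r + 1 →
      ∃ e ∈ cands, (∀ x ∈ U, xs.idxOf x ∈ e.1) ∧ e.2.length ≤ minCost U := by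
    rintro U ⟨hUR, hU⟩
    set T := (List.range n).filter fun i => decide (xs.getD i 0 ∈ U) with hT
    have hTmem : ∀ i, i ∈ T ↔ i < n ∧ xs.getD i 0 ∈ U := fun i => by simp [hT]
    have hpU : pointsAt xs T = U := by
      ext x
      simp only [pointsAt, List.mem_toFinset, List.mem_map]
      constructor
      · rintro ⟨i, hi, rfl⟩
        exact ((hTmem i).1 hi).2
      · intro hx
        obtain ⟨h1, h2⟩ := hidx x (hUR hx)
        exact ⟨_, (hTmem _).2 ⟨h1, by rwa [h2]⟩, h2⟩
    have hTlen : T.length ≤ Δ ^ r + 1 := by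
      refine le_trans (le_of_eq ?_) hU
      rw [← hpU, pointsAt, List.toFinset_card_of_nodup, List.length_map]
      refine (List.nodup_range.filter _).map_on fun i hi j hj hij => ?_
      rw [← hidx' i ((hTmem i).1 hi).1, ← hidx' j ((hTmem j).1 hj).1, hij]
    obtain ⟨e, he, heT⟩ := hall T List.filter_sublist hTlen
    refine ⟨e, he, fun x hx => ?_, ?_⟩
    · obtain ⟨h1, h2⟩ := hidx x (hUR hx)
      rw [heT, hTmem, h2]
      exact ⟨h1, hx⟩
    · have := hcost e he
      rwa [heT, hpU] at this
  choose! part hpart1 hpart2 hpart3 using hpart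
  have hpair : ∀ a ∈ R, ∀ b ∈ R,
      ({a, b} : Finset E) ⊆ R ∧ ({a, b} : Finset E).card ≤ Δ ^ r + 1 := by
    intro a ha b hb
    refine ⟨by simp [Finset.insert_subset_iff, ha, hb], Finset.card_le_two.trans ?_⟩
    have := Nat.one_le_pow r Δ (by omega)
    omega
  have hlength : ∀ H : List (Cand α), H ⊆ cands → (H.flatMap sol).length = totalCost H := by
    intro H hH
    rw [List.length_flatMap, totalCost]
    congr 1
    exact List.map_congr_left fun e he => (hlen e (hH he)).symm
  have hfeas : ∀ G : List (Cand α), G ⊆ cands → numLabels n (G.map fun e => e.1) ≤ 1 →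
      ∀ Y : Set E, (∀ x ∈ xs, x ∈ Y) → (∀ e ∈ G, ∀ z ∈ sol e, z ∈ Y) →
      ∀ x ∈ R, ∀ y ∈ R, Linked 1 Y x y := by
    intro G hG hG1 Y hY hY' x hx y hy
    refine linked_of_label_eq (fun e he => hc e (hG he)) (fun e he => (hopt e (hG he)).1) hY hY'
      (fun i hi j hj => ?_) x ((hmemR x).1 hx) y ((hmemR y).1 hy)
    rw [numLabels_eq, card_image_le_one_iff] at hG1
    exact hG1 i (Finset.mem_range.2 hi) j (Finset.mem_range.2 hj)
  -- Pairs of terminals are among the candidates, and those at distance at most `t + 1` cost at most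
  -- `t`. Hence layer `t` has at most as many components as the threshold graph at `t + 1`, and the
  -- spanning tree bound applies to the points of `G`.
  have hexcess : ∀ G : List (Cand α), G ⊆ cands → numLabels n (G.map fun e => e.1) ≤ 1 →
      excess n cands [] ≤ (Δ - 1) * totalCost G := by
    intro G hG hG1
    have h1 := sum_numComponents_sub_one_le hΔ (R := R) (S := (G.flatMap sol).toFinset)
      (hfeas G hG hG1 _ (fun x hx => by simp [hmemR, hx])
        (fun e he z hz => by
          simp only [Finset.coe_union, Set.mem_union, Finset.mem_coe, List.mem_toFinset,
            List.mem_flatMap]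
          exact Or.inr ⟨e, he, hz⟩)) (height cands)
    have h2 : (G.flatMap sol).toFinset.card ≤ totalCost G :=
      (List.toFinset_card_le _).trans (hlength G hG).le
    refine le_trans ?_ (h1.trans (Nat.mul_le_mul_left _ h2))
    rw [excess_eq]
    change _ ≤ ((Multiset.range _).map _).sum
    rw [Multiset.range, Multiset.map_coe, Multiset.sum_coe]
    refine List.sum_le_sum fun t _ => Nat.sub_le_sub_right ?_ 1
    rw [numLabels_eq]
    have h3 : (Finset.range n).image (label n (layered cands [] t)) =
        R.image fun x => label n (layered cands [] t) (xs.idxOf x) := by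
      ext l
      simp only [Finset.mem_image, Finset.mem_range]
      constructor
      · rintro ⟨i, hi, rfl⟩
        exact ⟨_, hpt i hi, by rw [hidx' i hi]⟩
      · rintro ⟨x, hx, rfl⟩
        exact ⟨_, (hidx x hx).1, rfl⟩
    rw [h3]
    refine card_image_le_numComponents _ fun a ha b hb hab => ?_
    have hU := hpair a ha b hb
    obtain ⟨S, hS, hl⟩ := exists_linked_of_dist_le t a b hab
    have hfS : Feasible ({a, b} : Finset E) S := by
      refine feasible_iff.2 fun x hx y hy => ?_
      rw [Finset.mem_insert, Finset.mem_singleton] at hx hy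
      rcases hx with rfl | rfl <;> rcases hy with rfl | rfl
      exacts [.refl, hl, hl.symm, .refl]
    have hle : (part {a, b}).2.length ≤ t :=
      (hpart3 _ hU).trans (hS ▸ Nat.sInf_le ⟨S, hfS, rfl⟩)
    refine label_eq_of_mem (lt_of_mem_layered hc (List.nil_subset _) t)
      (List.mem_append_right _ (mem_layer.2 ⟨_, hpart1 _ hU, hle, rfl⟩)) ?_ ?_
    · exact hpart2 _ hU a (by simp)
    · exact hpart2 _ hU b (by simp)
  have hrestr : ∀ S', Feasible R S' → ∃ G : List (Cand α), G ⊆ cands ∧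
      numLabels n (G.map fun e => e.1) ≤ 1 ∧ r * totalCost G ≤ (r + 2) * S'.length := by
    intro S' hS'
    obtain ⟨Hs, hH1, hH2, hH3⟩ := exists_restricted hΔ (by omega) hr (R := R) (S := S'.toFinset)
      (c := minCost) (fun x hx y hy => (feasible_iff.1 hS' x hx y hy).mono le_rfl fun z hz => by
        simpa using hz) (fun T B h => minCost_le h)
    have hGsub : Hs.toList.map part ⊆ cands := by
      intro e he
      obtain ⟨U, hU, rfl⟩ := List.mem_map.1 he
      exact hpart1 U (hH1 U (Finset.mem_toList.1 hU))
    refine ⟨Hs.toList.map part, hGsub, ?_, ?_⟩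
    · rw [numLabels_eq, card_image_le_one_iff]
      intro i hi j hj
      rw [Finset.mem_range] at hi hj
      have := hH2 (fun x => label n ((Hs.toList.map part).map fun e => e.1) (xs.idxOf x))
        (fun U hU x hx y hy => by
          refine label_eq_of_mem (fun T hT => ?_) (T := (part U).1) ?_
            (hpart2 U (hH1 U hU) x hx) (hpart2 U (hH1 U hU) y hy)
          · obtain ⟨e, he, rfl⟩ := List.mem_map.1 hT
            exact hc e (hGsub he)
          · exact List.mem_map_of_mem (List.mem_map_of_mem (Finset.mem_toList.2 hU)))
        _ (hpt i hi) _ (hpt j hj)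
      simpa only [hidx' i hi, hidx' j hj] using this
    · have h1 : totalCost (Hs.toList.map part) ≤ ∑ U ∈ Hs, minCost U := by
        rw [totalCost, List.map_map, Finset.sum_map_toList Hs]
        exact Finset.sum_le_sum fun U hU => hpart3 U (hH1 U hU)
      exact (Nat.mul_le_mul_left _ h1).trans
        (hH3.trans (Nat.mul_le_mul_left _ (List.toFinset_card_le _)))
  have hcands : numLabels n (cands.map fun e => e.1) ≤ 1 := by
    rw [numLabels_eq, card_image_le_one_iff]
    intro i hi j hj
    rw [Finset.mem_range] at hi hj
    have hU := hpair _ (hpt i hi) _ (hpt j hj)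
    have h1 := hpart2 _ hU (xs.getD i 0) (by simp)
    have h2 := hpart2 _ hU (xs.getD j 0) (by simp)
    rw [hidx' _ hi] at h1
    rw [hidx' _ hj] at h2
    refine label_eq_of_mem (fun T hT => ?_) (List.mem_map_of_mem (hpart1 _ hU)) h1 h2
    obtain ⟨e, he, rfl⟩ := List.mem_map.1 hT
    exact hc e he
  -- All candidates together connect the terminals, so feasibility needs no particular comparison
  -- solution.
  obtain ⟨hH, hH0, -⟩ := greedy_spec hc (List.Subset.refl cands) hcands
  refine ⟨hH, ?_, ?_⟩
  -- Zero excess means that layer `0`, which contains the candidates without points, is connected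
  -- with the chosen ones. Those extra candidates add no points to the solution.
  · refine feasible_iff.2 (hfeas (greedy n cands ++ cands.filter fun e => decide (e.2.length ≤ 0))
      (List.append_subset.2 ⟨hH, fun _ h => List.mem_of_mem_filter h⟩) ?_ _
      (fun x hx => Or.inl ((hmemR x).2 hx)) fun e he z hz => ?_)
    · rw [List.map_append, numLabels_eq, card_image_le_one_iff]
      intro i hi j hj
      exact label_eq_of_excess_eq_zero hH0 (Finset.mem_range.1 hi) (Finset.mem_range.1 hj)
    · rcases List.mem_append.1 he with he | he
      · exact Or.inr (List.mem_flatMap.2 ⟨e, he, hz⟩)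
      · rw [List.mem_filter, decide_eq_true_eq] at he
        have h0 : (sol e).length ≤ 0 := hlen e he.1 ▸ he.2
        rw [List.length_eq_zero_iff.1 (Nat.le_zero.1 h0)] at hz
        simp at hz
  · intro S' hS'
    obtain ⟨G, hG, hG1, hGc⟩ := hrestr S' hS'
    obtain ⟨-, -, h1⟩ := greedy_spec hc hG hG1
    have h2 := hexcess G hG hG1
    have hD : (1 : ℝ) ≤ (Δ : ℝ) - 1 := by
      have : (2 : ℝ) ≤ Δ := by exact_mod_cast hΔ2
      linarith
    have h3 : (excess n cands [] : ℝ) ≤ ((Δ : ℝ) - 1) * totalCost G := by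
      have : ((Δ - 1 : ℕ) : ℝ) = (Δ : ℝ) - 1 := by rw [Nat.cast_sub (by omega), Nat.cast_one]
      rw [← this]
      exact_mod_cast h2
    have h4 := h1.trans (greedyBound_le (Nat.cast_nonneg _) hD h3)
    have h5 : (r : ℝ) * totalCost G ≤ (r + 2) * S'.length := by exact_mod_cast hGc
    rw [hlength _ hH]
    have hlog := Real.log_nonneg hD
    calc (r : ℝ) * totalCost (greedy n cands)
        ≤ r * ((1 + Real.log ((Δ : ℝ) - 1)) * totalCost G) := by gcongr
      _ = (1 + Real.log ((Δ : ℝ) - 1)) * (r * totalCost G) := by ring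
      _ ≤ _ := by gcongr

end Correctness

section Algorithm

/-! ### The approximation algorithm as a program -/

variable {α ι : Type*} {op : ι → Data α → Data α}

/-- The index lists of length at most `k`, with the codes of the terminals. -/
def instances (k : ℕ) (cs : List (Data α)) : List (Cand α) :=
  (shortSublists k (List.range cs.length)).map fun T => (T, T.map fun i => cs.getD i Data.nil)

theorem PolyTime.instances (k : ℕ) :
    PolyTime op fun cs : List (Data α) => (cs.length, instances k cs) :=
  pair id.length (map (shortSublists k id.length.range)
    (pair id.snd (map id.snd (getD id.fst.fst id.snd nilData))))

theorem rep_listData (cs : List (Data α)) : (rep cs : Data α) = Data.ofList cs := by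
  change Data.ofList (cs.map fun d => d) = _
  rw [List.map_id']

/-- Replace, in each element of a list of pairs, the second component by the output of `p`. -/
def mapSecondProg (p : Prog ι) : Prog ι :=
  .pair .first (.seq (.pair .ident (.pair .nil .second))
    (foldProg (.pair (.pair (.seq .second (.seq .second .first))
      (.seq (.seq .second (.seq .second .second)) p)) (.seq .second .first))))

/-- A polynomial bound for `mapSecondProg p` in terms of the length of the input and a polynomial
bound for `p`. -/
noncomputable def mapSecondBound (m b : Polynomial ℕ) : Polynomial ℕ :=
  m * (m + 2 * b + 100) + 2 * m + 100

/-- `PolyTime.map` does not apply, since the assumed algorithm `p` is only known to halt on codes of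
instances, within a bound that also involves the diameter. So `p` is assumed to succeed on the
entries of `l` only, with a numerical bound `N`. The fold reverses the list, which is harmless. -/
theorem eval_mapSecondProg {p : Prog ι} {n N : ℕ} {l : List (Cand α)}
    {f : Cand α → List (Data α)} (h : ∀ e ∈ l, ∃ t, Eval op p (rep e.2) (rep (f e)) t ∧
      t + sz α (f e) ≤ N) :
    ∃ t, Eval op (mapSecondProg p) (rep (n, l)) (rep (n, (l.map fun e => (e.1, f e)).reverse)) t ∧
      t + sz α (n, (l.map fun e => (e.1, f e)).reverse) ≤
        sz α (n, l) * (sz α (n, l) + 2 * N + 100) + 2 * sz α (n, l) + 100 := by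
  obtain ⟨t, ht, hE⟩ := eval_foldProg (op := op)
    (p := .pair (.pair (.seq .second (.seq .second .first))
      (.seq (.seq .second (.seq .second .second)) p)) (.seq .second .first)) (rep (n, l))
    (fun (s : List (Cand α)) (e : Cand α) => (e.1, f e) :: s) (N + 20) l [] (by
      intro l₁ e l₂ hl
      obtain ⟨t, hE, ht⟩ := h e (by simp [hl])
      refine ⟨_, ?_, .pair (.pair (.seq (.second _) (.seq (.second _) (.first _)))
        (.seq (.seq (.second _) (.seq (.second _) (.second _))) hE))
        (.seq (.second _) (.first _))⟩
      omega)
  have hfold : ∀ (l s : List (Cand α)), l.foldl (fun s e => (e.1, f e) :: s) s =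
      (l.map fun e => (e.1, f e)).reverse ++ s := by
    intro l
    induction l with
    | nil => simp
    | cons a l ih => intro s; simp [ih]
  rw [hfold, List.append_nil] at hE
  refine ⟨_, .pair (.first _) (.seq (.pair (.ident _) (.pair (.nil _) (.second _))) hE), ?_⟩
  have h1 := sz_le_of_forall_le (α := α) (l.map fun e => (e.1, f e)).reverse
    (sz α l + N + 1) (fun a ha => by
      obtain ⟨e, he, rfl⟩ := List.mem_map.1 (List.mem_reverse.1 ha)
      obtain ⟨t, -, ht⟩ := h e he
      have h2 := sz_le_of_mem (α := α) he
      have h3 : sz α e = sz α e.1 + sz α e.2 + 1 := rfl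
      simp only [sz_pair]
      omega)
  rw [List.length_reverse, List.length_map] at h1
  have h2 := length_le_sz (α := α) l
  have h3 : sz α (n, l) = sz α n + sz α l + 1 := sz_pair _ _
  have h4 : l.length * (N + 20 + 30) ≤ sz α (n, l) * (N + 50) := Nat.mul_le_mul (by omega) (by omega)
  have h5 : l.length * (sz α l + N + 1 + 1) ≤ sz α (n, l) * (sz α (n, l) + N + 50) :=
    Nat.mul_le_mul (by omega) (by omega)
  have h6 : sz α (n, l) * (N + 50) + sz α (n, l) * (sz α (n, l) + N + 50) =
      sz α (n, l) * (sz α (n, l) + 2 * N + 100) := by ring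
  rw [sz_pair n (l.map fun e => (e.1, f e)).reverse]
  omega

theorem map_getD_sublist {A : Type*} {l : List A} {d : A} {T : List ℕ}
    (h : T.Sublist (List.range l.length)) : (T.map fun i => l.getD i d).Sublist l := by
  have h1 := h.map fun i => l.getD i d
  have h2 : (List.range l.length).map (fun i => l.getD i d) = l := by
    refine List.ext_getElem (by simp) fun i h1 h2 => ?_
    simp [h2]
  rwa [h2] at h1

theorem ratio_le {ρ ε r s : ℝ} (h : 2 * ρ ≤ r * ε) (hs : 0 ≤ s) :
    ρ * ((r + 2) * s) ≤ r * ((ρ + ε) * s) := by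
  have := mul_le_mul_of_nonneg_right h hs
  linarith

theorem hasApproximationScheme {E : Type*} [NormedAddCommGroup E] [NormedSpace ℝ E] [Nontrivial E]
    {Δ : ℕ} (hΔ : IsIndependenceNumber E Δ) {decode : Data α → Option E}
    (h : ConstantTerminalsSolvable op decode) :
    HasApproximationScheme op decode (1 + Real.log ((Δ : ℝ) - 1)) := by
  classical
  intro ε hε
  have hΔ2 := hΔ.two_le
  -- This makes `ρ * (r + 2) ≤ r * (ρ + ε)`, absorbing the loss from parts with few terminals.
  obtain ⟨r, hr⟩ := exists_nat_gt (2 * (1 + Real.log ((Δ : ℝ) - 1)) / ε)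
  have hρ : 0 < 1 + Real.log ((Δ : ℝ) - 1) := by
    have : (2 : ℝ) ≤ Δ := by exact_mod_cast hΔ2
    have := Real.log_nonneg (show (1 : ℝ) ≤ (Δ : ℝ) - 1 by linarith)
    linarith
  have hr0 : 0 < r := by
    have : (0 : ℝ) < r := lt_of_le_of_lt (by positivity) hr
    exact_mod_cast this
  obtain ⟨p, b, hp⟩ := h (Δ ^ r + 1)
  obtain ⟨p₁, b₁, hp₁⟩ := PolyTime.instances (op := op) (Δ ^ r + 1)
  obtain ⟨p₃, b₃, hp₃⟩ := PolyTime.greedySolution (op := op)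
    (PolyTime.id (X := ℕ × List (Cand α))).fst PolyTime.id.snd
  refine ⟨.seq p₁ (.seq (mapSecondProg p) p₃), b₁ + mapSecondBound b₁ (b.comp (b₁ + .X)) +
    b₃.comp (mapSecondBound b₁ (b.comp (b₁ + .X))) + 2, fun R v _ hv => ?_⟩
  obtain ⟨xs, ⟨cs, rfl, hcs⟩, hxs⟩ := hv
  have hlen : cs.length = xs.length := by simpa using congrArg List.length hcs
  have hnodup : xs.Nodup := by rw [← Multiset.coe_nodup, hxs]; exact R.nodup
  set N := (Data.ofList cs).size + ⌈Metric.diam (R : Set E)⌉₊ with hN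
  obtain ⟨t₁, hE₁, ht₁⟩ := hp₁ cs
  have hszcs : sz α cs = (Data.ofList cs).size := by rw [sz, rep_listData]
  have hM : t₁ + sz α (cs.length, instances (Δ ^ r + 1) cs) ≤ b₁.eval N :=
    ht₁.trans (eval_mono b₁ (by omega))
  -- A listed instance is part of the polynomially long list, and its diameter is at most that of
  -- `R`, so one bound holds for all calls.
  have horacle : ∀ e ∈ instances (Δ ^ r + 1) cs, ∃ (ws : List (Data α)) (S : List E),
      (∃ t, Eval op p (rep e.2) (rep ws) t ∧ t + sz α ws ≤ b.eval (b₁.eval N + N)) ∧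
      ws.map decode = S.map some ∧ IsOptimal (pointsAt xs e.1) S := by
    intro e he
    have hsz := sz_le_of_mem (α := α) he
    obtain ⟨T, hT, rfl⟩ := List.mem_map.1 he
    obtain ⟨hTs, hTk⟩ := mem_shortSublists.1 hT
    rw [hlen] at hTs
    have hsub : (T.map fun i => xs.getD i 0).Sublist xs := map_getD_sublist hTs
    have hval : ((T.map fun i => xs.getD i 0 : List E) : Multiset E) = (pointsAt xs T).val := by
      rw [pointsAt, List.toFinset_val, (hnodup.sublist hsub).dedup]
    have hcard : (pointsAt xs T).card ≤ Δ ^ r + 1 := by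
      rw [Finset.card_def, ← hval, Multiset.coe_card, List.length_map]
      exact hTk
    have hsubset : (pointsAt xs T : Set E) ⊆ R := fun x hx => by
      rw [Finset.mem_coe, ← Finset.mem_val, ← hval, Multiset.mem_coe] at hx
      rw [Finset.mem_coe, ← Finset.mem_val, ← hxs, Multiset.mem_coe]
      exact hsub.subset hx
    have hdecode : (T.map fun i => cs.getD i Data.nil).map decode =
        (T.map fun i => xs.getD i 0).map some := by
      rw [List.map_map, List.map_map]
      refine List.map_congr_left fun i hi => ?_
      have hi' : i < xs.length := List.mem_range.1 (hTs.subset hi)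
      have h1 := List.getElem_of_eq hcs (by simpa [hlen] using hi')
      simp only [List.getElem_map] at h1
      simp only [Function.comp_apply]
      rw [List.getD_eq_getElem _ _ (by omega), List.getD_eq_getElem _ _ hi', h1]
    obtain ⟨w, t, S, hE, ht, ⟨ws, rfl, hws⟩, hS⟩ :=
      hp _ _ hcard ⟨_, ⟨_, rfl, hdecode⟩, hval⟩
    refine ⟨ws, S, ⟨t, ?_, ?_⟩, hws, hS⟩
    · rw [rep_listData, rep_listData]; exact hE
    · rw [sz, rep_listData]
      refine ht.trans (eval_mono b (Nat.add_le_add ?_ ?_))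
      · rw [← rep_listData]
        have h1 : sz α (T, T.map fun i => cs.getD i Data.nil) = sz α T +
          sz α (T.map fun i => cs.getD i Data.nil) + 1 := sz_pair _ _
        have h2 : sz α (cs.length, instances (Δ ^ r + 1) cs) = sz α cs.length +
          sz α (instances (Δ ^ r + 1) cs) + 1 := sz_pair _ _
        change sz α (T.map fun i => cs.getD i Data.nil) ≤ _
        omega
      · exact (Nat.ceil_le_ceil (Metric.diam_mono hsubset R.finite_toSet.isBounded)).trans
          (Nat.le_add_left _ _)
  choose! ws sol horacle hws hsol using horacle
  obtain ⟨t₂, hE₂, ht₂⟩ := eval_mapSecondProg (n := cs.length) horacle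
  set cands := ((instances (Δ ^ r + 1) cs).map fun e => (e.1, ws e)).reverse with hcands
  obtain ⟨t₃, hE₃, ht₃⟩ := hp₃ (cs.length, cands)
  have hcand : ∀ e ∈ cands, ∃ S : List E, e.1.Sublist (List.range xs.length) ∧
      e.2.map decode = S.map some ∧ IsOptimal (pointsAt xs e.1) S := by
    intro e he
    obtain ⟨e, he', rfl⟩ := List.mem_map.1 (List.mem_reverse.1 he)
    refine ⟨sol e, ?_, hws e he', hsol e he'⟩
    obtain ⟨T, hT, rfl⟩ := List.mem_map.1 he'
    rw [← hlen]
    exact (mem_shortSublists.1 hT).1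
  choose! S hS₁ hS₂ hS₃ using hcand
  obtain ⟨hgc, hf, happ⟩ := greedy_correct hΔ hΔ2 hr0 hxs hS₁ (fun T hT hTk => by
      rw [← hlen] at hT
      refine ⟨_, List.mem_reverse.2 (List.mem_map_of_mem
        (List.mem_map_of_mem (mem_shortSublists.2 ⟨hT, hTk⟩))), rfl⟩) hS₃
    (fun e he => by simpa using congrArg List.length (hS₂ e he))
  refine ⟨_, _, (greedy xs.length cands).flatMap S, .seq (rep_listData cs ▸ hE₁) (.seq hE₂ hE₃),
    ?_, ⟨greedySolution cs.length cands, rep_listData _, ?_⟩, hf, fun S' hS' => ?_⟩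
  · have h1 : t₂ + sz α (cs.length, cands) ≤
        (mapSecondBound b₁ (b.comp (b₁ + .X))).eval N := by
      refine ht₂.trans ?_
      have h2 : sz α (cs.length, instances (Δ ^ r + 1) cs) ≤ b₁.eval N := by omega
      simp only [mapSecondBound, Polynomial.eval_add, Polynomial.eval_mul, Polynomial.eval_comp,
        Polynomial.eval_X, Polynomial.eval_ofNat]
      gcongr
    have h2 : t₃ + sz α (greedySolution cs.length cands) ≤
        b₃.eval ((mapSecondBound b₁ (b.comp (b₁ + .X))).eval N) :=
      ht₃.trans (eval_mono b₃ (by omega))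
    rw [sz] at h2
    rw [Polynomial.eval_add, Polynomial.eval_add, Polynomial.eval_add, Polynomial.eval_ofNat,
      Polynomial.eval_comp]
    change t₁ + (t₂ + t₃ + 1) + 1 + (rep (greedySolution cs.length cands) : Data α).size ≤ _
    omega
  · rw [greedySolution, hlen, List.map_flatMap, List.map_flatMap]
    exact List.flatMap_congr fun e he => hS₂ e (hgc he)
  · have h1 := happ S' hS'
    have hr' : (0 : ℝ) < r := by exact_mod_cast hr0
    exact le_of_mul_le_mul_left (h1.trans (ratio_le ((div_lt_iff₀ hε).1 hr).le
      (Nat.cast_nonneg _))) hr'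

end Algorithm

/-! ### Numerical bound and the main theorem -/

theorem log_four_lt : Real.log 4 < 1.3863 := by
  have h : Real.log 4 = 2 * Real.log 2 := by
    rw [show (4 : ℝ) = 2 ^ 2 by norm_num, Real.log_pow]; norm_num
  have := Real.log_two_lt_d9
  rw [h]
  norm_num at this ⊢
  linarith

end STMSP

theorem theorem1 :
    (∀ (E : Type*) [NormedAddCommGroup E] [NormedSpace ℝ E] [Nontrivial E] (Δ : ℕ),
      STMSP.IsIndependenceNumber E Δ →
      ∀ (α ι : Type*) (op : ι → STMSP.Data α → STMSP.Data α) (decode : STMSP.Data α → Option E),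
        STMSP.ConstantTerminalsSolvable op decode →
        STMSP.HasApproximationScheme op decode (1 + Real.log ((Δ : ℝ) - 1))) ∧
    STMSP.IsIndependenceNumber (EuclideanSpace ℝ (Fin 2)) 5 ∧
    (∀ (α ι : Type*) (op : ι → STMSP.Data α → STMSP.Data α)
        (decode : STMSP.Data α → Option (EuclideanSpace ℝ (Fin 2))),
      STMSP.ConstantTerminalsSolvable op decode →
      STMSP.HasApproximationScheme op decode (1 + Real.log 4)) ∧
    (∀ ε : ℝ, 1 + Real.log 4 + ε < 2.3863 + ε) := by
  refine ⟨fun E _ _ _ Δ hΔ α ι op decode h => STMSP.hasApproximationScheme hΔ h,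
    STMSP.isIndependenceNumber_plane, fun α ι op decode h => ?_, fun ε => ?_⟩
  · have := STMSP.hasApproximationScheme STMSP.isIndependenceNumber_plane h
    norm_num at this
    exact this
  · have := STMSP.log_four_lt
    norm_num at this ⊢
    linarith
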